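/- **Theorem (Consistency of Algorithm MRFA-AM with one iteration).** *Model.* Let $L\ge 1$, let $\theta\in\mathbb{C}^L$ with $\|\theta\|_2=1$, $\lambda>0$, $\sigma\ge 0$ ($\sigma$ known). All indices are modulo $L$, and $^*$ is (entrywise) complex conjugation, or the conjugate transpose. Let $(\mathcal{R}_s v)[\ell]=v[\ell-s]$, let $F[\ell,k]=L^{-1/2}e^{-2\pi\imath \ell k/L}$, and let $\mathrm{Circul}\{\alpha\}[k_1,k_2]=\alpha[k_2-k_1]$. We observe independent $y_i=\mathcal{R}_{s_i}\{a_i\theta\}+\eta_i$, $i=1,2,\ldots$, where $a_i\sim\mathcal{CN}(0,\lambda)$, $s_i$ uniform on $\mathbb{Z}_L$ and $\eta_i\sim\mathcal{CN}(0,\sigma^2I_L)$ are independent; write $\hat y_i=Fy_i$, $\hat\theta=F\theta$. Independently of the observations, initial phases $\phi[k]\sim U[0,1)$, $k\in\mathbb{Z}_L$, are drawn independently, once for all sample sizes. *Algorithm ($\tau=1$, sample size $N$).* 1. $\tilde p[k]=\frac1N\sum_{i=1}^N|\hat y_i[k]|^2-\sigma^2$, $\tilde\lambda=\sum_k|\tilde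 p[k]|$, $\tilde\theta_m[k]=\sqrt{\tilde p[k]/\tilde\lambda}$. 2. For $m=1,\ldots,L-1$: with $z_i^{(m)}[k]=\hat y_i[k]\hat y_i^*[k+m]$, let $\tilde C_z^{(m)}=\frac1N\sum_{i=1}^N z_i^{(m)}(z_i^{(m)})^*-\mathrm{Diag}_k\{\sigma^2(\tilde p[k]+\tilde p[k+m])\}$, let $w$ be any unit eigenvector of $\tilde C_z^{(m)}$ for its largest eigenvalue, and correct its phase: $\tilde u^{(m)}=w\cdot\exp\{-\frac{\imath}{L}\sum_k\arg w[k]\}\cdot e^{2\pi\imath j/L}$, with any choice of $j\in\{0,\ldots,L-1\}$. 3. Let $\tilde C_x[k,k]=1$ and $\tilde C_x[k_1,k_2]=\tilde u^{(k_2-k_1)}[k_1]/|\tilde u^{(k_2-k_1)}[k_1]|$ for $k_1\ne k_2$. 4. With $\tilde\alpha_0[k]=e^{2\pi\imath\phi[k]}$, let $\tilde q_1=s_1v_1$, where $s_1$ is the largest singular value of $\tilde C_x\odot\mathrm{Circul}\{\tilde\alpha_0^*\}$ and $v_1$ is any corresponding unit (left or right) singular vector. 5. Output $\tilde\theta=\tilde\theta_N=F^*(\tilde\theta_p\odot\tilde\theta_m)$,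 where $\tilde\theta_p[k]=\tilde q_1[k]/|\tilde q_1[k]|$. (The conventions used when a quotient or a square root is undefined are immaterial.) *Claim.* If $|\hat\theta[k]|>0$ for all $k$, then almost surely, for all choices left open in the algorithm (made separately for every $N$), there are $s_N\in\mathbb{Z}_L$ and $\alpha_N\in\mathbb{C}$ with $|\alpha_N|=1$ such that $$\lim_{N\to\infty}\bigl\|\theta-\alpha_N\mathcal{R}_{s_N}\{\tilde\theta_N\}\bigr\|_2=0 .$$ Moreover, if the choices are made so that the phases of the entry $\tilde u^{(m)}[0]$, for each $m=1,\ldots,L-1$, and of the entry $\tilde q_1[0]$ converge as $N\to\infty$, then there are $s\in\mathbb{Z}_L$ and $\alpha\in\mathbb{C}$, $|\alpha|=1$, not depending on $N$, with $\lim_{N\to\infty}\|\theta-\alpha\mathcal{R}_s\{\tilde\theta_N\}\|_2=0$. -/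

import Mathlib

open MeasureTheory ProbabilityTheory Filter Topology Matrix
open scoped NNReal

noncomputable section

namespace MRFA

/-! Vectors of length `L` are functions `ZMod L → ℂ`, so that every index is read modulo `L`. -/

/-- The Euclidean norm of a vector. -/
def l2norm {L : ℕ} [NeZero L] (v : ZMod L → ℂ) : ℝ := ‖WithLp.toLp 2 v‖

/-- The cyclic shift `R_s`. -/
def shift {L : ℕ} (s : ZMod L) (v : ZMod L → ℂ) : ZMod L → ℂ := fun l => v (l - s)

/-- The unitary DFT matrix `F[l, k] = ω ^ (l k) / √L`, with `ω = exp (-2πi / L)`. -/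
def dftMatrix (L : ℕ) : Matrix (ZMod L) (ZMod L) ℂ :=
  Matrix.of fun l k =>
    ((Real.sqrt L : ℝ) : ℂ)⁻¹ *
      Complex.exp (-(2 * Real.pi * Complex.I) / L) ^ (l.val * k.val)

/-- The circularly symmetric complex normal law `CN(0, v)`: independent real and imaginary parts,
each with law `N(0, v / 2)`. -/
def complexNormal (v : ℝ≥0) : Measure ℂ :=
  ((gaussianReal 0 (v / 2)).prod (gaussianReal 0 (v / 2))).map
    (fun p : ℝ × ℝ => (p.1 : ℂ) + (p.2 : ℂ) * Complex.I)

/-- The joint law of the scale factor `a ∼ CN(0, lam)`, the shift `s` (uniform on `ZMod L`) and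
the noise vector `η ∼ CN(0, σ² I)` of one observation, which are independent. -/
def latentLaw (L : ℕ) [NeZero L] (lam σ : ℝ≥0) : Measure (ℂ × ZMod L × (ZMod L → ℂ)) :=
  (complexNormal lam).prod
    ((uniformOn (Set.univ : Set (ZMod L))).prod
      (Measure.pi fun _ : ZMod L => complexNormal (σ ^ 2)))

/-- The law of `L` independent variables, each uniform on `[0, 1)`. -/
def initialPhaseLaw (L : ℕ) [NeZero L] : Measure (ZMod L → ℝ) :=
  Measure.pi fun _ : ZMod L => volume.restrict (Set.Ico (0 : ℝ) 1)

/-- The observation `y = R_s (a θ) + η`. -/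
def observation {L : ℕ} (θ : ZMod L → ℂ) (p : ℂ × ZMod L × (ZMod L → ℂ)) : ZMod L → ℂ :=
  shift p.2.1 (p.1 • θ) + p.2.2

section Statistics

variable {L : ℕ} [NeZero L]

/-- `ŷ = F y`. -/
def dft (y : ZMod L → ℂ) : ZMod L → ℂ := dftMatrix L *ᵥ y

/-- The power spectrum estimate from the `N` observations `y 0, …, y (N - 1)`. -/
def powerEst (σ : ℝ≥0) (N : ℕ) (y : ℕ → ZMod L → ℂ) (k : ZMod L) : ℝ :=
  (N : ℝ)⁻¹ * ∑ i ∈ Finset.range N, ‖dft (y i) k‖ ^ 2 - (σ : ℝ) ^ 2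

/-- The estimate of the signal strength. -/
def lamEst (σ : ℝ≥0) (N : ℕ) (y : ℕ → ZMod L → ℂ) : ℝ := ∑ k, |powerEst σ N y k|

/-- The estimate of the Fourier magnitudes of the signal. -/
def magnitudeEst (σ : ℝ≥0) (N : ℕ) (y : ℕ → ZMod L → ℂ) (k : ZMod L) : ℝ :=
  Real.sqrt (powerEst σ N y k / lamEst σ N y)

/-- The stride-`m` products `z^(m)[k] = ŷ[k] ŷ*[k + m]`. -/
def strideProd (m : ZMod L) (y : ZMod L → ℂ) : ZMod L → ℂ :=
  fun k => dft y k * star (dft y (k + m))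

/-- The sample covariance matrix of `z^(m)`, with the bias correction of its diagonal. -/
def strideCov (σ : ℝ≥0) (N : ℕ) (y : ℕ → ZMod L → ℂ) (m : ZMod L) :
    Matrix (ZMod L) (ZMod L) ℂ :=
  (N : ℂ)⁻¹ • ∑ i ∈ Finset.range N, vecMulVec (strideProd m (y i)) (star (strideProd m (y i)))
    - diagonal fun k =>
        (((σ : ℝ) ^ 2 * (powerEst σ N y k + powerEst σ N y (k + m)) : ℝ) : ℂ)

/-- `w` is a normalized eigenvector for the largest eigenvalue of the Hermitian matrix `A`. -/
def IsLeadingEigenvector (A : Matrix (ZMod L) (ZMod L) ℂ) (w : ZMod L → ℂ) : Prop :=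
  l2norm w = 1 ∧ ∃ ev : ℝ, A *ᵥ w = (ev : ℂ) • w ∧
    ∀ (ev' : ℝ) (x : ZMod L → ℂ), x ≠ 0 → A *ᵥ x = (ev' : ℂ) • x → ev' ≤ ev

/-- The phase correction of an eigenvector: after the multiplication by
`exp (-(i / L) ∑ arg w[k])` the arguments of the entries add up to `0` modulo `2π`, and so they
still do after the multiplication by the root of unity `exp (2πi j / L)`. -/
def phaseCorrect (j : ZMod L) (w : ZMod L → ℂ) : ZMod L → ℂ := fun k =>
  w k * Complex.exp (-(Complex.I / L) * ((∑ l, Complex.arg (w l) : ℝ) : ℂ)) *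
    Complex.exp (2 * Real.pi * Complex.I * (j.val : ℂ) / L)

/-- The matrix `C̃_x`, with ones on the diagonal and the phases of `u^(m)` on the `m`-th
(wrapped) diagonal. -/
def phaseMatrix (u : ZMod L → ZMod L → ℂ) : Matrix (ZMod L) (ZMod L) ℂ :=
  Matrix.of fun k₁ k₂ =>
    if k₁ = k₂ then 1 else u (k₂ - k₁) k₁ / ((‖u (k₂ - k₁) k₁‖ : ℝ) : ℂ)

/-- `Circul{α}[k₁, k₂] = α[k₂ - k₁]`. -/
def circul (α : ZMod L → ℂ) : Matrix (ZMod L) (ZMod L) ℂ := Matrix.of fun k₁ k₂ => α (k₂ - k₁)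

/-- `s` is a singular value of `M` with (unit) left singular vector `v` and right singular
vector `w`. -/
def IsSingularTriple (M : Matrix (ZMod L) (ZMod L) ℂ) (s : ℝ) (v w : ZMod L → ℂ) : Prop :=
  0 ≤ s ∧ l2norm v = 1 ∧ l2norm w = 1 ∧ M *ᵥ w = (s : ℂ) • v ∧ Mᴴ *ᵥ v = (s : ℂ) • w

/-- The `q`-step: `q = s₁ v₁`, where `s₁` is the largest singular value of `M` and `v₁` a
corresponding (left or right) singular vector. -/
def IsQStep (M : Matrix (ZMod L) (ZMod L) ℂ) (q : ZMod L → ℂ) : Prop :=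
  ∃ (s : ℝ) (v w : ZMod L → ℂ), IsSingularTriple M s v w ∧
    (∀ (s' : ℝ) (v' w' : ZMod L → ℂ), IsSingularTriple M s' v' w' → s' ≤ s) ∧
    (q = (s : ℂ) • v ∨ q = (s : ℂ) • w)

/-- The `α`-step: `α[k]` is the phase of `∑ q*[l] q[l + k] C[l, l + k]`. -/
def alphaStep (C : Matrix (ZMod L) (ZMod L) ℂ) (q : ZMod L → ℂ) : ZMod L → ℂ := fun k =>
  Complex.exp (Complex.I * (Complex.arg (∑ l, star (q l) * q (l + k) * C l (l + k)) : ℂ))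

/-- A run of the alternating minimization algorithm with noise level `σ`, `τ` iterations, the
observations `y 0, …, y (N - 1)` and the initial phases `φ`. The fields record the choices that
the algorithm leaves open: the eigenvectors `w m`, the roots of unity in the phase correction (any
choice is allowed, in particular the one that makes the argument of the entry `0` minimal) and
the singular vectors. -/
structure AMRun (σ : ℝ≥0) (τ N : ℕ) (y : ℕ → ZMod L → ℂ) (φ : ZMod L → ℝ) where
  w : ZMod L → ZMod L → ℂ
  j : ZMod L → ZMod L
  q : ℕ → ZMod L → ℂ
  α : ℕ → ZMod L → ℂ
  w_spec : ∀ m : ZMod L, m ≠ 0 → IsLeadingEigenvector (strideCov σ N y m) (w m)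
  α_init : ∀ k, α 0 k = Complex.exp (2 * Real.pi * Complex.I * (φ k : ℂ))
  q_step : ∀ t < τ,
    IsQStep (phaseMatrix (fun m => phaseCorrect (j m) (w m)) ⊙ circul (star (α t))) (q (t + 1))
  α_step : ∀ t < τ,
    α (t + 1) = alphaStep (phaseMatrix fun m => phaseCorrect (j m) (w m)) (q (t + 1))

variable {σ : ℝ≥0} {τ N : ℕ} {y : ℕ → ZMod L → ℂ} {φ : ZMod L → ℝ}

/-- The estimate `ũ^(m)` of the run, for `m ≠ 0`. -/
def AMRun.u (r : AMRun σ τ N y φ) (m : ZMod L) : ZMod L → ℂ := phaseCorrect (r.j m) (r.w m)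

/-- The output of the run: the phases of `q_τ`, combined with the estimated magnitudes, and
transformed back by `F*`. -/
def AMRun.estimate (r : AMRun σ τ N y φ) : ZMod L → ℂ :=
  (dftMatrix L)ᴴ *ᵥ fun k =>
    r.q τ k / ((‖r.q τ k‖ : ℝ) : ℂ) * (magnitudeEst σ N y k : ℂ)

end Statistics

end MRFA

end

/-! Write χ for `ZMod.stdAddChar`. A shift is a modulation in the Fourier domain, so ŷ[k] = χ(-sk) a
θ̂[k] + noise, and given the shift s the ŷ[k] are linear forms in independent circular Gaussians. By
the Isserlis (Wick) formula the second moments of z^(m) do not depend on s. After the bias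
correction the law of large numbers gives C̃_z^(m) → 2λ² z z* + σ⁴ I with z[k] = θ̂[k] θ̂*[k+m]
(`mean_strideProd`, `ae_tendsto_statistics`). The leading eigenspace of the limit is spanned by z.
Since ∏ z[k] > 0, the phase correction determines the remaining scalar up to an L-th root of unity
ζ[m] (`exists_phase_limit_of_leading`).

Let P[k] be the phase of θ̂[k]. The matrix of the q-step then tends to diag(P) Circul{γ} diag(P)*
with γ[m] = ζ[m] e^{-2πiφ[m]} and ζ[0] = 1. Fourier vectors diagonalize circulants. If the moduli of
the eigenvalues `phaseSum` are distinct, the top singular vectors are therefore multiples of P[l]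
χ(k₀ l): the phases of θ̂ up to a global phase and the shift by -k₀ (`eq_of_maximal_conjCircul`).
Ties have probability zero in φ, simultaneously for the finitely many ζ
(`ae_forall_norm_phaseSum_ne`).

The choices vary freely with N, so ζ, k₀ and the global phase c need not converge. Limits are taken
along ultrafilters below `atTop`, where unit vectors always converge (`exists_limit_of_runs`). The
best alignment error tends to 0 along each of them, hence along `atTop`. If the phases of the
entries at 0 converge, every ultrafilter yields the same ζ, k₀ and c, and one fixed alignment works.
-/

noncomputable section

namespace MRFA

/-! ### The DFT: unitarity, shifts and circulants -/

section Fourier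

lemma sqrt_inv_mul_sqrt_inv (L : ℕ) :
    ((Real.sqrt L : ℝ) : ℂ)⁻¹ * ((Real.sqrt L : ℝ) : ℂ)⁻¹ = (L : ℂ)⁻¹ := by
  rw [← mul_inv, ← Complex.ofReal_mul, Real.mul_self_sqrt (Nat.cast_nonneg L)]
  simp

lemma shift_smul {L : ℕ} (s : ZMod L) (c : ℂ) (v : ZMod L → ℂ) : shift s (c • v) = c • shift s v := rfl

lemma shift_shift {L : ℕ} (s t : ZMod L) (v : ZMod L → ℂ) : shift s (shift t v) = shift (s + t) v := by
  ext l
  simp only [shift, sub_sub]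

lemma shift_zero {L : ℕ} (v : ZMod L → ℂ) : shift 0 v = v := by
  ext l
  simp [shift]

variable {L : ℕ} [NeZero L]

lemma norm_stdAddChar (x : ZMod L) : ‖(ZMod.stdAddChar x : ℂ)‖ = 1 := by
  rw [ZMod.stdAddChar_apply, Circle.norm_coe]

lemma star_stdAddChar (x : ZMod L) :
    star (ZMod.stdAddChar x : ℂ) = ZMod.stdAddChar (-x) := by
  rw [ZMod.stdAddChar_apply, ZMod.stdAddChar_apply, AddChar.map_neg_eq_inv, Circle.coe_inv_eq_conj]
  rfl

lemma dftMatrix_apply (l k : ZMod L) :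
    dftMatrix L l k = ((Real.sqrt L : ℝ) : ℂ)⁻¹ * ZMod.stdAddChar (-(l * k)) := by
  have h : (-(l * k) : ZMod L) = ((-((l.val * k.val : ℕ) : ℤ) : ℤ) : ZMod L) := by
    push_cast
    simp
  rw [h, ZMod.stdAddChar_coe, dftMatrix, Matrix.of_apply, ← Complex.exp_nat_mul]
  congr 2
  push_cast
  ring

lemma dft_apply (y : ZMod L → ℂ) (k : ZMod L) :
    dft y k = ((Real.sqrt L : ℝ) : ℂ)⁻¹ * ∑ l, ZMod.stdAddChar (-(k * l)) * y l := by
  simp only [dft, Matrix.mulVec, dotProduct, dftMatrix_apply, mul_assoc, Finset.mul_sum]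

lemma sum_stdAddChar_mul (t : ZMod L) :
    ∑ i, (ZMod.stdAddChar (t * i) : ℂ) = if t = 0 then (L : ℂ) else 0 := by
  split_ifs with h
  · simp [h, ZMod.card]
  · exact AddChar.sum_eq_zero_of_ne_one (ZMod.isPrimitive_stdAddChar L h)

lemma dftMatrix_mul_conjTranspose : dftMatrix L * (dftMatrix L)ᴴ = 1 := by
  have hL : (L : ℂ) ≠ 0 := Nat.cast_ne_zero.mpr (NeZero.ne L)
  ext k k'
  have h : ∀ l : ZMod L, dftMatrix L k l * star (dftMatrix L k' l)
      = (L : ℂ)⁻¹ * ZMod.stdAddChar ((k' - k) * l) := by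
    intro l
    rw [dftMatrix_apply, dftMatrix_apply, star_mul', star_stdAddChar, mul_mul_mul_comm,
      ← AddChar.map_add_eq_mul, ← sqrt_inv_mul_sqrt_inv L]
    congr 2
    · simp [Complex.conj_ofReal]
    · ring
  simp only [Matrix.mul_apply, Matrix.conjTranspose_apply, h, ← Finset.mul_sum,
    sum_stdAddChar_mul, Matrix.one_apply, sub_eq_zero]
  by_cases hk : k = k' <;> simp [hk, hL, eq_comm]

lemma conjTranspose_mul_dftMatrix : (dftMatrix L)ᴴ * dftMatrix L = 1 :=
  mul_eq_one_comm.mp dftMatrix_mul_conjTranspose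

lemma conjTranspose_dftMatrix_mulVec_dft (v : ZMod L → ℂ) : (dftMatrix L)ᴴ *ᵥ dft v = v := by
  rw [dft, Matrix.mulVec_mulVec, conjTranspose_mul_dftMatrix, Matrix.one_mulVec]

lemma dft_smul (c : ℂ) (v : ZMod L → ℂ) : dft (c • v) = c • dft v :=
  Matrix.mulVec_smul _ _ _

lemma dft_add (v w : ZMod L → ℂ) : dft (v + w) = dft v + dft w :=
  Matrix.mulVec_add _ _ _

lemma dft_shift (s : ZMod L) (v : ZMod L → ℂ) (k : ZMod L) :
    dft (shift s v) k = ZMod.stdAddChar (-(s * k)) * dft v k := by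
  rw [dft_apply, dft_apply, mul_left_comm, ← Equiv.sum_comp (Equiv.addRight s)]
  congr 1
  rw [Finset.mul_sum]
  refine Finset.sum_congr rfl fun l _ => ?_
  simp only [shift, Equiv.coe_addRight, add_sub_cancel_right]
  rw [← mul_assoc, ← AddChar.map_add_eq_mul]
  congr 2
  ring

lemma l2norm_sq (v : ZMod L → ℂ) : l2norm v ^ 2 = ∑ k, ‖v k‖ ^ 2 := by
  rw [l2norm, EuclideanSpace.norm_sq_eq]

lemma l2norm_nonneg (v : ZMod L → ℂ) : 0 ≤ l2norm v := norm_nonneg _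

lemma l2norm_eq_one_iff (v : ZMod L → ℂ) : l2norm v = 1 ↔ ∑ k, ‖v k‖ ^ 2 = 1 := by
  rw [← l2norm_sq, pow_eq_one_iff_of_nonneg (l2norm_nonneg v) two_ne_zero]

lemma star_dotProduct_self (v : ZMod L → ℂ) : star v ⬝ᵥ v = ((∑ k, ‖v k‖ ^ 2 : ℝ) : ℂ) := by
  simp only [dotProduct, Pi.star_apply, Complex.ofReal_sum, Complex.ofReal_pow]
  exact Finset.sum_congr rfl fun k _ => Complex.conj_mul' (v k)

lemma sum_norm_dft_sq (v : ZMod L → ℂ) : ∑ k, ‖dft v k‖ ^ 2 = ∑ k, ‖v k‖ ^ 2 := by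
  have h := star_dotProduct_self (dft v)
  rw [dft, Matrix.star_mulVec, ← Matrix.dotProduct_mulVec, Matrix.mulVec_mulVec,
    conjTranspose_mul_dftMatrix, Matrix.one_mulVec, star_dotProduct_self] at h
  exact_mod_cast h.symm

/-- Since `circul` has entries γ[k₂ - k₁], it acts as a correlation rather than a convolution; this
is why the eigenvalue carries χ(km) and not χ(-km). -/
lemma dft_circul_mulVec (γ v : ZMod L → ℂ) (k : ZMod L) :
    dft (circul γ *ᵥ v) k = (∑ m, γ m * ZMod.stdAddChar (k * m)) * dft v k := by
  rw [dft_apply, dft_apply, mul_left_comm]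
  congr 1
  simp only [circul, Matrix.mulVec, dotProduct, Matrix.of_apply, Finset.mul_sum]
  rw [Finset.sum_comm]
  refine Finset.sum_congr rfl fun l _ => ?_
  rw [Finset.sum_mul, ← Equiv.sum_comp (Equiv.subLeft l)]
  refine Finset.sum_congr rfl fun m _ => ?_
  have h : (ZMod.stdAddChar (-(k * (l - m))) : ℂ)
      = ZMod.stdAddChar (k * m) * ZMod.stdAddChar (-(k * l)) := by
    rw [← AddChar.map_add_eq_mul]
    congr 1
    ring
  simp only [Equiv.subLeft_apply, sub_sub_cancel, h]
  ring

end Fourier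

/-! ### Moments of the complex normal law -/

section Moments

lemma integral_sq_gaussianReal (v : ℝ≥0) : ∫ x, x ^ 2 ∂(gaussianReal 0 v) = v := by
  have h := variance_id_gaussianReal (μ := 0) (v := v)
  rw [variance_eq_sub (memLp_id_gaussianReal 2), show ∫ x, id x ∂(gaussianReal 0 v) = 0 from integral_id_gaussianReal] at h
  simpa using h

/-- Read off as the fourth derivative at 0 of the moment generating function exp(v t²/2). -/
lemma integral_pow_four_gaussianReal (v : ℝ≥0) :
    ∫ x, x ^ 4 ∂(gaussianReal 0 v) = 3 * (v : ℝ) ^ 2 := by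
  have hE : ∀ t : ℝ, HasDerivAt (fun t : ℝ => Real.exp (v * t ^ 2 / 2))
      (v * t * Real.exp (v * t ^ 2 / 2)) t := by
    intro t
    have h : HasDerivAt (fun t : ℝ => (v : ℝ) * t ^ 2 / 2) (v * t) t := by
      convert! (((hasDerivAt_pow 2 t).const_mul (v : ℝ)).div_const 2) using 1
      simp; ring
    simpa [mul_comm] using h.exp
  have d1 : deriv (fun t : ℝ => Real.exp (v * t ^ 2 / 2))
      = fun t => v * t * Real.exp (v * t ^ 2 / 2) := funext fun t => (hE t).deriv
  have d2 : deriv (fun t : ℝ => v * t * Real.exp (v * t ^ 2 / 2))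
      = fun t => (v + v ^ 2 * t ^ 2) * Real.exp (v * t ^ 2 / 2) := by
    funext t
    refine HasDerivAt.deriv ?_
    convert! (((hasDerivAt_id t).const_mul (v : ℝ))).mul (hE t) using 1
    simp; ring
  have d3 : deriv (fun t : ℝ => ((v : ℝ) + v ^ 2 * t ^ 2) * Real.exp (v * t ^ 2 / 2))
      = fun t => (3 * v ^ 2 * t + v ^ 3 * t ^ 3) * Real.exp (v * t ^ 2 / 2) := by
    funext t
    refine HasDerivAt.deriv ?_
    convert! (((hasDerivAt_pow 2 t).const_mul ((v : ℝ) ^ 2)).const_add (v : ℝ)).mul (hE t) using 1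
    simp; ring
  have d4 : HasDerivAt (fun t : ℝ => (3 * (v : ℝ) ^ 2 * t + v ^ 3 * t ^ 3)
      * Real.exp (v * t ^ 2 / 2)) (3 * (v : ℝ) ^ 2) 0 := by
    convert! ((((hasDerivAt_id (0 : ℝ)).const_mul (3 * (v : ℝ) ^ 2)).add
      ((hasDerivAt_pow 3 (0 : ℝ)).const_mul ((v : ℝ) ^ 3))).mul (hE 0)) using 1
    simp
  have h := iteratedDeriv_mgf_zero (X := fun x : ℝ => x) (μ := gaussianReal 0 v) (by simp) 4
  rw [mgf_fun_id_gaussianReal] at h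
  simp only [zero_mul, zero_add, iteratedDeriv_succ, iteratedDeriv_zero, d1, d2, d3, d4.deriv] at h
  simpa using h.symm

lemma integrable_pow_gaussianReal (v : ℝ≥0) (n : ℕ) :
    Integrable (fun x : ℝ => x ^ n) (gaussianReal 0 v) := by
  rw [← integrable_norm_iff (by fun_prop)]
  simpa using (memLp_id_gaussianReal (μ := 0) (v := v) n).integrable_norm_pow'

instance (v : ℝ≥0) : IsProbabilityMeasure (complexNormal v) :=
  Measure.isProbabilityMeasure_map (by fun_prop)

lemma memLp_id_complexNormal (v : ℝ≥0) (n : ℕ) : MemLp id n (complexNormal v) := by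
  rw [complexNormal, memLp_map_measure_iff (by fun_prop) (by fun_prop)]
  have h : MemLp (id : ℝ → ℝ) n (gaussianReal 0 (v / 2)) := memLp_id_gaussianReal n
  have h1 := (h.comp_measurePreserving
    (measurePreserving_fst (μ := gaussianReal 0 (v / 2)) (ν := gaussianReal 0 (v / 2)))).ofReal
    (K := ℂ)
  have h2 := (h.comp_measurePreserving
    (measurePreserving_snd (μ := gaussianReal 0 (v / 2)) (ν := gaussianReal 0 (v / 2)))).ofReal
    (K := ℂ)
  exact h1.add (h2.mul_const Complex.I)

lemma integrable_mixed_complexNormal (v : ℝ≥0) (p q : ℕ) :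
    Integrable (fun z : ℂ => z ^ p * star z ^ q) (complexNormal v) := by
  rw [← integrable_norm_iff (by fun_prop)]
  convert! (memLp_id_complexNormal v (p + q)).integrable_norm_pow' using 2 with z
  simp [pow_add]

lemma measurePreserving_I_mul_complexNormal (v : ℝ≥0) :
    MeasurePreserving (fun z : ℂ => Complex.I * z) (complexNormal v) (complexNormal v) := by
  refine ⟨by fun_prop, ?_⟩
  have hneg : MeasurePreserving (fun x : ℝ => -x) (gaussianReal 0 (v / 2))
      (gaussianReal 0 (v / 2)) := ⟨by fun_prop, by simpa using gaussianReal_map_neg (μ := 0)⟩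
  have h := ((hneg.prod (MeasurePreserving.id (gaussianReal 0 (v / 2)))).comp
    Measure.measurePreserving_swap).map_eq
  rw [complexNormal, Measure.map_map (by fun_prop) (by fun_prop)]
  conv_rhs => rw [← h]
  rw [Measure.map_map (by fun_prop) (by fun_prop)]
  congr 1
  ext p
  simp only [Function.comp, Prod.swap, Prod.map, id]
  push_cast
  linear_combination (p.2 : ℂ) * Complex.I_sq

/-- The law is invariant under multiplication by i, which multiplies the moment by i^(p-q). The
bounds on p and q make this factor different from 1. -/
lemma integral_mixed_complexNormal_eq_zero (v : ℝ≥0) {p q : ℕ} (hp : p ≤ 2) (hq : q ≤ 2)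
    (hpq : p ≠ q) : ∫ z, z ^ p * star z ^ q ∂(complexNormal v) = 0 := by
  have h := (measurePreserving_I_mul_complexNormal v).hasLaw.integral_comp
    (f := fun z : ℂ => z ^ p * star z ^ q) (by fun_prop)
  have h' : ∀ z : ℂ, (Complex.I * z) ^ p * star (Complex.I * z) ^ q
      = (Complex.I ^ p * (-Complex.I) ^ q) * (z ^ p * star z ^ q) := by
    intro z
    simp [mul_pow]
    ring
  simp only [Function.comp_def, h'] at h
  rw [integral_const_mul] at h
  have hc : Complex.I ^ p * (-Complex.I) ^ q ≠ 1 := by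
    interval_cases p <;> interval_cases q <;> simp_all [Complex.ext_iff] <;> norm_num
  have : (Complex.I ^ p * (-Complex.I) ^ q - 1) * ∫ z, z ^ p * star z ^ q ∂(complexNormal v) = 0 := by
    linear_combination h
  exact (mul_eq_zero.mp this).resolve_left (sub_ne_zero.mpr hc)

lemma integral_mixed_complexNormal (v : ℝ≥0) {p q : ℕ} (hp : p ≤ 2) (hq : q ≤ 2) :
    ∫ z, z ^ p * star z ^ q ∂(complexNormal v)
      = if p = q then (p.factorial : ℂ) * ((v : ℝ) : ℂ) ^ p else 0 := by
  split_ifs with h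
  swap
  · exact integral_mixed_complexNormal_eq_zero v hp hq h
  subst h
  have e : ∀ z : ℂ, z ^ p * star z ^ p = ((Complex.normSq z ^ p : ℝ) : ℂ) := by
    intro z
    rw [← mul_pow, Complex.ofReal_pow, Complex.normSq_eq_conj_mul_self, mul_comm]
    rfl
  simp only [e]
  rw [integral_complex_ofReal, ← Complex.ofReal_natCast, ← Complex.ofReal_pow, ← Complex.ofReal_mul]
  congr 1
  rw [complexNormal, integral_map (by fun_prop)
    (show Continuous fun z : ℂ => Complex.normSq z ^ p from
      Complex.continuous_normSq.pow p).aestronglyMeasurable]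
  have hn : ∀ x : ℝ × ℝ, Complex.normSq ((x.1 : ℂ) + (x.2 : ℂ) * Complex.I) = x.1 ^ 2 + x.2 ^ 2 :=
    fun x => by rw [Complex.normSq_add_mul_I]
  simp only [hn]
  have i2 := integrable_pow_gaussianReal (v / 2) 2
  have i4 := integrable_pow_gaussianReal (v / 2) 4
  have m2 := integral_sq_gaussianReal (v / 2)
  have m4 := integral_pow_four_gaussianReal (v / 2)
  push_cast at m2 m4
  interval_cases p
  · simp
  · simp only [pow_one]
    rw [integral_add (i2.comp_fst _) (i2.comp_snd _), integral_fun_fst (fun x : ℝ => x ^ 2),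
      integral_fun_snd (fun x : ℝ => x ^ 2), m2]
    simp
  -- Each part has variance v/2, so E|z|⁴ = 2 · 3(v/2)² + 2(v/2)² = 2v².
  · have e2 : ∀ x : ℝ × ℝ, (x.1 ^ 2 + x.2 ^ 2) ^ 2
        = (x.1 ^ 4 + x.2 ^ 4) + 2 * (x.1 ^ 2 * x.2 ^ 2) := fun x => by ring
    have i44 : Integrable (fun x : ℝ × ℝ => x.1 ^ 4 + x.2 ^ 4)
        ((gaussianReal 0 (v / 2)).prod (gaussianReal 0 (v / 2))) :=
      (i4.comp_fst _).add (i4.comp_snd _)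
    simp only [e2]
    rw [integral_add i44 ((i2.mul_prod i2).const_mul 2),
      integral_add (i4.comp_fst _) (i4.comp_snd _), integral_fun_fst (fun x : ℝ => x ^ 4),
      integral_fun_snd (fun x : ℝ => x ^ 4), integral_const_mul,
      integral_prod_mul (fun x : ℝ => x ^ 2) (fun x : ℝ => x ^ 2), m2, m4]
    simp
    ring

end Moments

/-! ### Isserlis' formula for linear forms in the latent coordinates -/

section Wick

variable {L : ℕ} [NeZero L]

/-- The independent complex normal coordinates of one observation: the scale factor (`none`) and
the entries of the noise vector. -/
def coord (p : ℂ × ZMod L × (ZMod L → ℂ)) (o : Option (ZMod L)) : ℂ := o.elim p.1 p.2.2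

/-- The variances of the coordinates. -/
def coordVar (lam σ : ℝ≥0) (o : Option (ZMod L)) : ℝ≥0 := o.elim lam fun _ => σ ^ 2

instance : IsProbabilityMeasure (uniformOn (Set.univ : Set (ZMod L))) :=
  isProbabilityMeasure_uniformOn Set.finite_univ Set.univ_nonempty

instance (lam σ : ℝ≥0) : IsProbabilityMeasure (latentLaw L lam σ) := by
  unfold latentLaw; infer_instance

/-- The weight h(s) is carried through all the moment computations; indicators of a shift inserted
for it later play the role of conditioning on s. -/
lemma integrable_prod_coord (lam σ : ℝ≥0) (h : ZMod L → ℂ) (g : Option (ZMod L) → ℂ → ℂ)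
    (hg : ∀ o, Integrable (g o) (complexNormal (coordVar lam σ o))) :
    Integrable (fun p => h p.2.1 * ∏ o, g o (coord p o)) (latentLaw L lam σ) := by
  have h1 := (hg none).mul_prod ((Integrable.of_finite (f := h)
    (μ := uniformOn (Set.univ : Set (ZMod L)))).mul_prod
      (Integrable.fintype_prod (fun k => hg (some k))))
  refine h1.congr (Eventually.of_forall fun p => ?_)
  simp only [Fintype.prod_option, coord, Option.elim]
  ring

lemma integral_prod_coord (lam σ : ℝ≥0) (h : ZMod L → ℂ) (g : Option (ZMod L) → ℂ → ℂ) :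
    ∫ p, h p.2.1 * ∏ o, g o (coord p o) ∂(latentLaw L lam σ)
      = (∫ s, h s ∂(uniformOn (Set.univ : Set (ZMod L)))) *
        ∏ o, ∫ z, g o z ∂(complexNormal (coordVar lam σ o)) := by
  have e : ∀ p : ℂ × ZMod L × (ZMod L → ℂ), h p.2.1 * ∏ o, g o (coord p o)
      = g none p.1 * (h p.2.1 * ∏ k, g (some k) (p.2.2 k)) := by
    intro p
    simp only [Fintype.prod_option, coord, Option.elim]
    ring
  simp only [e, latentLaw]
  rw [integral_prod_mul (g none) (fun q : ZMod L × (ZMod L → ℂ) =>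
    h q.1 * ∏ k, g (some k) (q.2 k)), integral_prod_mul h (fun η : ZMod L → ℂ =>
    ∏ k, g (some k) (η k)), integral_fintype_prod_eq_prod, Fintype.prod_option]
  simp only [coordVar, Option.elim]
  ring

lemma integrable_mixed_coord (lam σ : ℝ≥0) (h : ZMod L → ℂ) (p q : Option (ZMod L) → ℕ) :
    Integrable (fun x => h x.2.1 * ∏ o, (coord x o ^ p o * star (coord x o) ^ q o))
      (latentLaw L lam σ) :=
  integrable_prod_coord lam σ h (fun o z => z ^ p o * star z ^ q o)
    fun _ => integrable_mixed_complexNormal _ _ _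

lemma integral_mixed_coord (lam σ : ℝ≥0) (h : ZMod L → ℂ) {p q : Option (ZMod L) → ℕ}
    (hp : ∀ o, p o ≤ 2) (hq : ∀ o, q o ≤ 2) :
    ∫ x, h x.2.1 * ∏ o, (coord x o ^ p o * star (coord x o) ^ q o) ∂(latentLaw L lam σ)
      = (∫ s, h s ∂(uniformOn (Set.univ : Set (ZMod L)))) *
        ∏ o, if p o = q o then ((p o).factorial : ℂ) * ((coordVar lam σ o : ℝ) : ℂ) ^ p o else 0 := by
  rw [integral_prod_coord lam σ h (fun o z => z ^ p o * star z ^ q o)]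
  congr 1
  exact Finset.prod_congr rfl fun o _ => integral_mixed_complexNormal _ (hp o) (hq o)

lemma prod_pow_indicator {ι : Type*} [Fintype ι] [DecidableEq ι] (f : ι → ℂ) (i : ι) :
    ∏ o, f o ^ (if o = i then 1 else 0) = f i := by
  simp [pow_ite]

lemma mixed_second_eq {ι : Type*} [Fintype ι] [DecidableEq ι] (ζ : ι → ℂ) (i j : ι) :
    ∏ o, (ζ o ^ (if o = i then 1 else 0) * star (ζ o) ^ (if o = j then 1 else 0))
      = ζ i * star (ζ j) := by
  rw [Finset.prod_mul_distrib, prod_pow_indicator, prod_pow_indicator (fun o => star (ζ o))]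

/-- Coding the four indices as exponent vectors turns the monomial into a product over coordinates,
to which independence applies whether or not the indices coincide. -/
lemma mixed_fourth_eq {ι : Type*} [Fintype ι] [DecidableEq ι] (ζ : ι → ℂ) (i j k l : ι) :
    ∏ o, (ζ o ^ ((if o = i then 1 else 0) + (if o = l then 1 else 0)) *
        star (ζ o) ^ ((if o = j then 1 else 0) + (if o = k then 1 else 0)))
      = ζ i * star (ζ j) * star (ζ k) * ζ l := by
  simp only [pow_add, Finset.prod_mul_distrib]
  rw [prod_pow_indicator, prod_pow_indicator, prod_pow_indicator (fun o => star (ζ o)),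
    prod_pow_indicator (fun o => star (ζ o))]
  ring

lemma prod_second_moments {ι : Type*} [Fintype ι] [DecidableEq ι] (V : ι → ℂ) (i j : ι) :
    (∏ o, if (if o = i then 1 else 0) = (if o = j then 1 else 0) then
        (((if o = i then 1 else 0 : ℕ)).factorial : ℂ) * V o ^ (if o = i then 1 else 0) else 0)
      = if i = j then V i else 0 := by
  by_cases h : i = j
  · subst h
    rw [if_pos rfl, ← prod_pow_indicator V i]
    refine Finset.prod_congr rfl fun o _ => ?_
    by_cases ho : o = i <;> simp [ho]
  · rw [if_neg h]
    exact Finset.prod_eq_zero (Finset.mem_univ i) (by simp [h])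

/-- Only balanced monomials survive, that is {i, l} = {j, k} as multisets. When all four indices
agree, the factor 2! accounts for both pairings. -/
lemma prod_fourth_moments {ι : Type*} [Fintype ι] [DecidableEq ι] (V : ι → ℂ) (i j k l : ι) :
    (∏ o, if (if o = i then 1 else 0) + (if o = l then 1 else 0)
          = (if o = j then 1 else 0) + (if o = k then 1 else 0) then
        ((((if o = i then 1 else 0) + (if o = l then 1 else 0) : ℕ)).factorial : ℂ) *
          V o ^ ((if o = i then 1 else 0) + (if o = l then 1 else 0)) else 0)
      = (if i = j then V i else 0) * (if l = k then V l else 0) +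
        (if i = k then V i else 0) * (if l = j then V l else 0) := by
  have hpair : (∏ o, if (if o = i then 1 else 0) + (if o = l then 1 else 0)
          = (if o = i then 1 else 0) + (if o = l then 1 else 0) then
        ((((if o = i then 1 else 0) + (if o = l then 1 else 0) : ℕ)).factorial : ℂ) *
          V o ^ ((if o = i then 1 else 0) + (if o = l then 1 else 0)) else 0)
      = V i * V l + (if i = l then V i * V l else 0) := by
    by_cases h : i = l
    · subst h
      rw [Finset.prod_eq_single i]
      · simp
        ring
      · intro o _ ho
        simp [ho]
      · simp
    · rw [if_neg h, add_zero, ← prod_pow_indicator V i, ← prod_pow_indicator V l,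
        ← Finset.prod_mul_distrib]
      refine Finset.prod_congr rfl fun o _ => ?_
      rw [if_pos rfl, pow_add]
      by_cases hi : o = i
      · simp [hi, h]
      · by_cases hl : o = l
        · subst hl
          simp [hi]
        · simp [hi, hl]
  by_cases hij : i = j
  · subst hij
    by_cases hlk : l = k
    · subst hlk
      rw [hpair]
      by_cases h : i = l <;> simp [h, eq_comm]
    · rw [Finset.prod_eq_zero (Finset.mem_univ l)]
      · by_cases h : i = k
        · subst h; simp [hlk]
        · simp [hlk, h]
      · rw [if_neg]
        by_cases h : l = i <;> simp [h, hlk]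
        subst h; simp [hlk]
  · by_cases hik : i = k
    · subst hik
      by_cases hlj : l = j
      · subst hlj
        simp only [add_comm (if _ = l then 1 else 0 : ℕ)] at hpair ⊢
        rw [hpair]
        simp [hij]
      · rw [Finset.prod_eq_zero (Finset.mem_univ j)]
        · simp [hlj, hij]
        · simp [Ne.symm hlj, Ne.symm hij]
    · rw [Finset.prod_eq_zero (Finset.mem_univ i)]
      · simp [hij, hik]
      · simp [hij, hik]

/-- The Hermitian form `∑ V a conj b`, the covariance of the linear forms with coefficient vectors
`a` and `b` in the coordinates. -/
def covForm (lam σ : ℝ≥0) (a b : Option (ZMod L) → ℂ) : ℂ :=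
  ∑ o, ((coordVar lam σ o : ℝ) : ℂ) * (a o * star (b o))

/-- The linear form with coefficient vector `a` in the coordinates. -/
def linForm (a : Option (ZMod L) → ℂ) (x : ℂ × ZMod L × (ZMod L → ℂ)) : ℂ := ∑ o, a o * coord x o

lemma linForm_mul_star (a b : Option (ZMod L) → ℂ) (x : ℂ × ZMod L × (ZMod L → ℂ)) :
    linForm a x * star (linForm b x)
      = ∑ i, ∑ j, (a i * star (b j)) *
        ∏ o, (coord x o ^ (if o = i then 1 else 0) * star (coord x o) ^ (if o = j then 1 else 0)) := by
  simp only [mixed_second_eq, linForm, star_sum, star_mul', Finset.sum_mul_sum]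
  refine Finset.sum_congr rfl fun i _ => Finset.sum_congr rfl fun j _ => ?_
  ring

lemma linForm_mul_four (a b c d : Option (ZMod L) → ℂ) (x : ℂ × ZMod L × (ZMod L → ℂ)) :
    linForm a x * star (linForm b x) * (star (linForm c x) * linForm d x)
      = ∑ i, ∑ j, ∑ k, ∑ l, (a i * star (b j) * star (c k) * d l) *
        ∏ o, (coord x o ^ ((if o = i then 1 else 0) + (if o = l then 1 else 0)) *
        star (coord x o) ^ ((if o = j then 1 else 0) + (if o = k then 1 else 0))) := by
  simp only [mixed_fourth_eq, linForm, star_sum, star_mul', Finset.sum_mul_sum]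
  refine Finset.sum_congr rfl fun i _ => ?_
  rw [Finset.sum_comm]
  refine Finset.sum_congr rfl fun j _ =>
    Finset.sum_congr rfl fun k _ => Finset.sum_congr rfl fun l _ => ?_
  ring

lemma integrable_linForm_two (lam σ : ℝ≥0) (h : ZMod L → ℂ) (a b : Option (ZMod L) → ℂ) :
    Integrable (fun x => h x.2.1 * (linForm a x * star (linForm b x))) (latentLaw L lam σ) := by
  simp only [linForm_mul_star, Finset.mul_sum]
  refine integrable_finsetSum _ fun i _ => integrable_finsetSum _ fun j _ => ?_
  simp only [mul_left_comm (h _)]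
  exact (integrable_mixed_coord lam σ h _ _).const_mul _

lemma integral_linForm_two (lam σ : ℝ≥0) (h : ZMod L → ℂ) (a b : Option (ZMod L) → ℂ) :
    ∫ x, h x.2.1 * (linForm a x * star (linForm b x)) ∂(latentLaw L lam σ)
      = (∫ s, h s ∂(uniformOn (Set.univ : Set (ZMod L)))) * covForm lam σ a b := by
  have hint : ∀ i j, Integrable (fun x => (a i * star (b j)) * (h x.2.1 *
      ∏ o, (coord x o ^ (if o = i then 1 else 0) * star (coord x o) ^ (if o = j then 1 else 0))))
      (latentLaw L lam σ) := fun i j => (integrable_mixed_coord lam σ h _ _).const_mul _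
  simp only [linForm_mul_star, Finset.mul_sum, mul_left_comm (h _)]
  rw [integral_finsetSum _ fun i _ => integrable_finsetSum _ fun j _ => hint i j, covForm,
    Finset.mul_sum]
  refine Finset.sum_congr rfl fun i _ => ?_
  rw [integral_finsetSum _ fun j _ => hint i j]
  have hle : ∀ i o : Option (ZMod L), (if o = i then 1 else 0) ≤ 2 := fun i o => by
    split_ifs <;> norm_num
  simp only [integral_const_mul, integral_mixed_coord lam σ h (hle i) (hle _),
    prod_second_moments fun o => ((coordVar lam σ o : ℝ) : ℂ)]
  simp
  ring

lemma integrable_linForm_four (lam σ : ℝ≥0) (h : ZMod L → ℂ) (a b c d : Option (ZMod L) → ℂ) :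
    Integrable (fun x => h x.2.1 *
      (linForm a x * star (linForm b x) * (star (linForm c x) * linForm d x)))
      (latentLaw L lam σ) := by
  simp only [linForm_mul_four, Finset.mul_sum]
  refine integrable_finsetSum _ fun i _ => integrable_finsetSum _ fun j _ =>
    integrable_finsetSum _ fun k _ => integrable_finsetSum _ fun l _ => ?_
  simp only [mul_left_comm (h _)]
  exact (integrable_mixed_coord lam σ h _ _).const_mul _

lemma integral_linForm_four (lam σ : ℝ≥0) (h : ZMod L → ℂ) (a b c d : Option (ZMod L) → ℂ) :
    ∫ x, h x.2.1 * (linForm a x * star (linForm b x) * (star (linForm c x) * linForm d x))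
        ∂(latentLaw L lam σ)
      = (∫ s, h s ∂(uniformOn (Set.univ : Set (ZMod L)))) *
        (covForm lam σ a b * covForm lam σ d c + covForm lam σ a c * covForm lam σ d b) := by
  have hint : ∀ i j k l, Integrable (fun x => (a i * star (b j) * star (c k) * d l) * (h x.2.1 *
      ∏ o, (coord x o ^ ((if o = i then 1 else 0) + (if o = l then 1 else 0)) *
        star (coord x o) ^ ((if o = j then 1 else 0) + (if o = k then 1 else 0)))))
      (latentLaw L lam σ) := fun i j k l => (integrable_mixed_coord lam σ h _ _).const_mul _
  have hle : ∀ i l o : Option (ZMod L),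
      (if o = i then 1 else 0) + (if o = l then 1 else 0) ≤ 2 := fun i l o => by
    split_ifs <;> norm_num
  have hterm : ∀ i j k l, ∫ x, (a i * star (b j) * star (c k) * d l) * (h x.2.1 *
      ∏ o, (coord x o ^ ((if o = i then 1 else 0) + (if o = l then 1 else 0)) *
        star (coord x o) ^ ((if o = j then 1 else 0) + (if o = k then 1 else 0))))
        ∂(latentLaw L lam σ) = (∫ s, h s ∂(uniformOn (Set.univ : Set (ZMod L)))) *
        ((a i * star (b j) * star (c k) * d l) *
        ((if i = j then ((coordVar lam σ i : ℝ) : ℂ) else 0) *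
          (if l = k then ((coordVar lam σ l : ℝ) : ℂ) else 0) +
        (if i = k then ((coordVar lam σ i : ℝ) : ℂ) else 0) *
          (if l = j then ((coordVar lam σ l : ℝ) : ℂ) else 0))) := by
    intro i j k l
    rw [integral_const_mul, integral_mixed_coord lam σ h (hle i l) (hle j k),
      prod_fourth_moments fun o => ((coordVar lam σ o : ℝ) : ℂ)]
    ring
  simp only [linForm_mul_four, Finset.mul_sum, mul_left_comm (h _)]
  rw [integral_finsetSum _ fun i _ => integrable_finsetSum _ fun j _ =>
    integrable_finsetSum _ fun k _ => integrable_finsetSum _ fun l _ => hint i j k l]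
  have hsum : ∀ i, ∫ x, ∑ j, ∑ k, ∑ l, (a i * star (b j) * star (c k) * d l) * (h x.2.1 *
      ∏ o, (coord x o ^ ((if o = i then 1 else 0) + (if o = l then 1 else 0)) *
        star (coord x o) ^ ((if o = j then 1 else 0) + (if o = k then 1 else 0))))
        ∂(latentLaw L lam σ) = (∫ s, h s ∂(uniformOn (Set.univ : Set (ZMod L)))) *
        ∑ j, ∑ k, ∑ l, ((a i * star (b j) * star (c k) * d l) *
        ((if i = j then ((coordVar lam σ i : ℝ) : ℂ) else 0) *
          (if l = k then ((coordVar lam σ l : ℝ) : ℂ) else 0) +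
        (if i = k then ((coordVar lam σ i : ℝ) : ℂ) else 0) *
          (if l = j then ((coordVar lam σ l : ℝ) : ℂ) else 0))) := by
    intro i
    rw [integral_finsetSum _ fun j _ => integrable_finsetSum _ fun k _ =>
      integrable_finsetSum _ fun l _ => hint i j k l, Finset.mul_sum]
    refine Finset.sum_congr rfl fun j _ => ?_
    rw [integral_finsetSum _ fun k _ => integrable_finsetSum _ fun l _ => hint i j k l,
      Finset.mul_sum]
    refine Finset.sum_congr rfl fun k _ => ?_
    rw [integral_finsetSum _ fun l _ => hint i j k l, Finset.mul_sum]
    exact Finset.sum_congr rfl fun l _ => hterm i j k l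
  simp only [hsum, ← Finset.mul_sum]
  congr 1
  simp only [mul_add, Finset.sum_add_distrib, covForm, Finset.sum_mul_sum]
  congr 1
  · refine Finset.sum_congr rfl fun i _ => ?_
    simp [-Fintype.sum_option]
    exact Finset.sum_congr rfl fun l _ => by ring
  · refine Finset.sum_congr rfl fun i _ => ?_
    simp [-Fintype.sum_option]
    exact Finset.sum_congr rfl fun l _ => by ring

end Wick

/-! ### Limits of the empirical statistics -/

section Consistency

variable {L : ℕ} [NeZero L]

/-- The coefficients of `ŷ[k]` as a linear form in the coordinates, when the shift is `s`. -/
def obsCoef (θ : ZMod L → ℂ) (s k : ZMod L) (o : Option (ZMod L)) : ℂ :=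
  o.elim (dft (shift s θ) k) fun l => dftMatrix L k l

lemma dft_observation (θ : ZMod L → ℂ) (x : ℂ × ZMod L × (ZMod L → ℂ)) (k : ZMod L) :
    dft (observation θ x) k = linForm (obsCoef θ x.2.1 k) x := by
  rw [observation, shift_smul, dft_add, dft_smul]
  simp only [linForm, Fintype.sum_option, obsCoef, coord, Option.elim, Pi.add_apply, Pi.smul_apply,
    smul_eq_mul, mul_comm x.1]
  rfl

lemma covForm_obsCoef (lam σ : ℝ≥0) (θ : ZMod L → ℂ) (s k k' : ZMod L) :
    covForm lam σ (obsCoef θ s k) (obsCoef θ s k')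
      = ((lam : ℝ) : ℂ) * (ZMod.stdAddChar (s * (k' - k)) * (dft θ k * star (dft θ k')))
        + if k = k' then ((σ : ℝ) : ℂ) ^ 2 else 0 := by
  have h := congrFun (congrFun (dftMatrix_mul_conjTranspose (L := L)) k) k'
  simp only [Matrix.mul_apply, Matrix.conjTranspose_apply, Matrix.one_apply] at h
  simp only [covForm, Fintype.sum_option, obsCoef, coordVar, Option.elim, ← Finset.mul_sum, h,
    dft_shift, star_mul', star_stdAddChar, mul_ite, mul_one, mul_zero]
  congr 1
  · have he : (ZMod.stdAddChar (s * (k' - k)) : ℂ)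
        = ZMod.stdAddChar (-(s * k)) * ZMod.stdAddChar (-(-(s * k'))) := by
      rw [← AddChar.map_add_eq_mul]
      congr 1
      ring
    rw [he]
    ring
  · push_cast
    rfl

lemma integral_uniform_indicator_sum :
    ∑ s₀ : ZMod L, ∫ s, (if s = s₀ then (1 : ℂ) else 0) ∂(uniformOn (Set.univ : Set (ZMod L)))
      = 1 := by
  rw [← integral_finsetSum _ fun _ _ => Integrable.of_finite]
  simp

/-- If the mean given the shift is the same number c for every shift, then c is the mean. The proof
splits the integrand by indicators of the shift. -/
lemma hasMean_of_forall_shift {lam σ : ℝ≥0}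
    {F : ZMod L → ℂ × ZMod L × (ZMod L → ℂ) → ℂ} {c : ℂ}
    (hF : ∀ h : ZMod L → ℂ, ∀ s, Integrable (fun x => h x.2.1 * F s x) (latentLaw L lam σ))
    (hc : ∀ h : ZMod L → ℂ, ∀ s, ∫ x, h x.2.1 * F s x ∂(latentLaw L lam σ)
      = (∫ s, h s ∂(uniformOn (Set.univ : Set (ZMod L)))) * c) :
    Integrable (fun x => F x.2.1 x) (latentLaw L lam σ) ∧
      ∫ x, F x.2.1 x ∂(latentLaw L lam σ) = c := by
  have e : ∀ x : ℂ × ZMod L × (ZMod L → ℂ),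
      F x.2.1 x = ∑ s₀, (if x.2.1 = s₀ then (1 : ℂ) else 0) * F s₀ x := fun x => by simp
  have hi : ∀ s₀ : ZMod L, Integrable
      (fun x : ℂ × ZMod L × (ZMod L → ℂ) => (if x.2.1 = s₀ then (1 : ℂ) else 0) * F s₀ x)
      (latentLaw L lam σ) :=
    fun s₀ => hF (fun s => if s = s₀ then (1 : ℂ) else 0) s₀
  simp only [e]
  refine ⟨integrable_finsetSum _ fun s₀ _ => hi s₀, ?_⟩
  rw [integral_finsetSum _ fun s₀ _ => hi s₀]
  simp only [fun s₀ : ZMod L => hc (fun s => if s = s₀ then (1 : ℂ) else 0) s₀, ← Finset.sum_mul,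
    integral_uniform_indicator_sum, one_mul]

lemma mean_power (lam σ : ℝ≥0) (θ : ZMod L → ℂ) (k : ZMod L) :
    Integrable (fun x => dft (observation θ x) k * star (dft (observation θ x) k))
        (latentLaw L lam σ) ∧
      ∫ x, dft (observation θ x) k * star (dft (observation θ x) k) ∂(latentLaw L lam σ)
        = ((lam * ‖dft θ k‖ ^ 2 + (σ : ℝ) ^ 2 : ℝ) : ℂ) := by
  simp only [dft_observation]
  refine hasMean_of_forall_shift
    (F := fun s x => linForm (obsCoef θ s k) x * star (linForm (obsCoef θ s k) x))
    (fun h s => integrable_linForm_two lam σ h _ _) fun h s => ?_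
  rw [integral_linForm_two, covForm_obsCoef]
  have : dft θ k * star (dft θ k) = (‖dft θ k‖ : ℂ) ^ 2 := Complex.mul_conj' _
  rw [this]
  simp

/-- Of the two Isserlis pairings, (k₁, k₁+m)(k₂+m, k₂) is free of noise because m ≠ 0, while (k₁,
k₂)(k₂+m, k₁+m) picks up noise on the diagonal only. The modulations by s cancel in both, and each
contributes λ² z z*, whence the factor 2. -/
lemma mean_strideProd (lam σ : ℝ≥0) (θ : ZMod L → ℂ) {m : ZMod L} (hm : m ≠ 0) (k₁ k₂ : ZMod L) :
    Integrable (fun x => strideProd m (observation θ x) k₁ * star (strideProd m (observation θ x) k₂))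
        (latentLaw L lam σ) ∧
      ∫ x, strideProd m (observation θ x) k₁ * star (strideProd m (observation θ x) k₂)
          ∂(latentLaw L lam σ)
        = 2 * ((lam : ℝ) : ℂ) ^ 2 * (strideProd m θ k₁ * star (strideProd m θ k₂)) +
          if k₁ = k₂ then (((σ : ℝ) ^ 2 * (lam * ‖dft θ k₁‖ ^ 2 + lam * ‖dft θ (k₁ + m)‖ ^ 2)
            + (σ : ℝ) ^ 4 : ℝ) : ℂ) else 0 := by
  simp only [strideProd, dft_observation, star_mul', star_star]
  refine hasMean_of_forall_shift
    (F := fun s x => linForm (obsCoef θ s k₁) x * star (linForm (obsCoef θ s (k₁ + m)) x) *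
      (star (linForm (obsCoef θ s k₂) x) * linForm (obsCoef θ s (k₂ + m)) x))
    (fun h s => integrable_linForm_four lam σ h _ _ _ _) fun h s => ?_
  rw [integral_linForm_four]
  congr 1
  simp only [covForm_obsCoef]
  have h1 : ∀ k : ZMod L, k ≠ k + m := fun k => by simpa using hm
  have h2 : (ZMod.stdAddChar (s * m) : ℂ) * ZMod.stdAddChar (-(s * m)) = 1 := by
    rw [← AddChar.map_add_eq_mul]; simp
  rw [if_neg (h1 k₁), if_neg (h1 k₂).symm]
  have e1 : s * (k₁ + m - k₁) = s * m := by ring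
  have e2 : s * (k₂ - (k₂ + m)) = -(s * m) := by ring
  rw [e1, e2]
  by_cases hk : k₁ = k₂
  · subst hk
    have n1 : (‖dft θ k₁‖ : ℂ) ^ 2 = dft θ k₁ * star (dft θ k₁) := (Complex.mul_conj' _).symm
    have n2 : (‖dft θ (k₁ + m)‖ : ℂ) ^ 2 = dft θ (k₁ + m) * star (dft θ (k₁ + m)) :=
      (Complex.mul_conj' _).symm
    simp only [if_true, sub_self, mul_zero, AddChar.map_zero_eq_one]
    push_cast
    rw [n1, n2]
    linear_combination (lam : ℂ) ^ 2 * (dft θ k₁ * star (dft θ (k₁ + m)) *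
      (dft θ (k₁ + m) * star (dft θ k₁))) * h2
  · have hk' : k₂ + m ≠ k₁ + m := fun h => hk (add_right_cancel h).symm
    rw [if_neg hk, if_neg hk', if_neg hk]
    have h3 : (ZMod.stdAddChar (s * (k₂ - k₁)) : ℂ)
        * ZMod.stdAddChar (s * (k₁ + m - (k₂ + m))) = 1 := by
      rw [← AddChar.map_add_eq_mul, ← AddChar.map_zero_eq_one (ZMod.stdAddChar (N := L))]
      congr 1
      ring
    linear_combination (lam : ℂ) ^ 2 * (dft θ k₁ * star (dft θ (k₁ + m)) *
      (dft θ (k₂ + m) * star (dft θ k₂))) * (h2 + h3)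

lemma ae_tendsto_average {Ω E : Type*} [MeasurableSpace Ω] {mE : MeasurableSpace E} {μ : Measure Ω}
    {ν : Measure E} {X : ℕ → Ω → E} (hX : ∀ i, HasLaw (X i) ν μ) (hXindep : iIndepFun X μ)
    {g : E → ℂ} (hg : Measurable g) (hint : Integrable g ν) :
    ∀ᵐ ω ∂μ, Tendsto (fun N : ℕ => (N : ℂ)⁻¹ * ∑ i ∈ Finset.range N, g (X i ω)) atTop
      (𝓝 (∫ x, g x ∂ν)) := by
  have h := strong_law_ae (μ := μ) (fun i ω => g (X i ω))
    ((hX 0).map_eq ▸ hint |>.comp_aemeasurable (hX 0).aemeasurable)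
    (fun i j hij => (hXindep.indepFun hij).comp hg hg)
    (fun i => IdentDistrib.comp ⟨(hX i).aemeasurable, (hX 0).aemeasurable, by
      rw [(hX i).map_eq, (hX 0).map_eq]⟩ hg)
  have h0 : ∫ ω, g (X 0 ω) ∂μ = ∫ x, g x ∂ν :=
    (hX 0).integral_comp hg.aestronglyMeasurable
  simpa [h0] using h

lemma continuous_dft : Continuous (dft (L := L)) := by
  unfold dft
  fun_prop

lemma measurable_observation (θ : ZMod L → ℂ) : Measurable (observation θ) := by
  have h : Measurable (fun x : ZMod L × ℂ => shift x.1 (x.2 • θ)) := by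
    refine measurable_from_prod_countable_right fun s => ?_
    refine measurable_pi_lambda _ fun l => ?_
    simp only [shift, Pi.smul_apply, smul_eq_mul]
    fun_prop
  exact (h.comp (measurable_snd.fst.prodMk measurable_fst)).add measurable_snd.snd

lemma ae_tendsto_statistics {Ω : Type*} [MeasurableSpace Ω] {μ : Measure Ω}
    (θ : ZMod L → ℂ) (lam σ : ℝ≥0) {X : ℕ → Ω → ℂ × ZMod L × (ZMod L → ℂ)}
    (hX : ∀ i, HasLaw (X i) (latentLaw L lam σ) μ) (hXindep : iIndepFun X μ) :
    ∀ᵐ ω ∂μ,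
      (∀ k, Tendsto (fun N => powerEst σ N (fun i => observation θ (X i ω)) k) atTop
        (𝓝 (lam * ‖dft θ k‖ ^ 2))) ∧
      ∀ m : ZMod L, m ≠ 0 →
        Tendsto (fun N => strideCov σ N (fun i => observation θ (X i ω)) m) atTop
          (𝓝 ((2 * ((lam : ℝ) : ℂ) ^ 2) • vecMulVec (strideProd m θ) (star (strideProd m θ))
            + (((σ : ℝ) ^ 4 : ℝ) : ℂ) • (1 : Matrix (ZMod L) (ZMod L) ℂ))) := by
  have hmeas : ∀ k, Measurable fun x : ℂ × ZMod L × (ZMod L → ℂ) => dft (observation θ x) k :=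
    fun k => (measurable_pi_apply k).comp
      (continuous_dft.measurable.comp (measurable_observation θ))
  have hstar : ∀ k, Measurable fun x : ℂ × ZMod L × (ZMod L → ℂ) =>
    star (dft (observation θ x) k) := fun k => continuous_star.measurable.comp (hmeas k)
  have hpow : ∀ᵐ ω ∂μ, ∀ k, Tendsto (fun N : ℕ => (N : ℂ)⁻¹ * ∑ i ∈ Finset.range N,
      dft (observation θ (X i ω)) k * star (dft (observation θ (X i ω)) k)) atTop
      (𝓝 ((lam * ‖dft θ k‖ ^ 2 + (σ : ℝ) ^ 2 : ℝ) : ℂ)) := by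
    refine ae_all_iff.mpr fun k => ?_
    have h := ae_tendsto_average hX hXindep
      (g := fun x => dft (observation θ x) k * star (dft (observation θ x) k))
      ((hmeas k).mul (hstar k)) (mean_power lam σ θ k).1
    rwa [(mean_power lam σ θ k).2] at h
  have hcov : ∀ᵐ ω ∂μ, ∀ m : ZMod L, m ≠ 0 → ∀ k₁ k₂,
      Tendsto (fun N : ℕ => (N : ℂ)⁻¹ * ∑ i ∈ Finset.range N,
        strideProd m (observation θ (X i ω)) k₁ * star (strideProd m (observation θ (X i ω)) k₂))
        atTop (𝓝 (2 * ((lam : ℝ) : ℂ) ^ 2 * (strideProd m θ k₁ * star (strideProd m θ k₂)) +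
          if k₁ = k₂ then (((σ : ℝ) ^ 2 * (lam * ‖dft θ k₁‖ ^ 2 + lam * ‖dft θ (k₁ + m)‖ ^ 2)
            + (σ : ℝ) ^ 4 : ℝ) : ℂ) else 0)) := by
    refine ae_all_iff.mpr fun m => ae_all_iff.mpr fun hm => ae_all_iff.mpr fun k₁ =>
      ae_all_iff.mpr fun k₂ => ?_
    have hz : ∀ k, Measurable fun x : ℂ × ZMod L × (ZMod L → ℂ) =>
      strideProd m (observation θ x) k := fun k => (hmeas k).mul (hstar (k + m))
    have h := ae_tendsto_average hX hXindep
      (g := fun x => strideProd m (observation θ x) k₁ * star (strideProd m (observation θ x) k₂))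
      ((hz k₁).mul (continuous_star.measurable.comp (hz k₂))) (mean_strideProd lam σ θ hm k₁ k₂).1
    rwa [(mean_strideProd lam σ θ hm k₁ k₂).2] at h
  filter_upwards [hpow, hcov] with ω h1 h2
  have hp : ∀ k, Tendsto (fun N => powerEst σ N (fun i => observation θ (X i ω)) k) atTop
        (𝓝 (lam * ‖dft θ k‖ ^ 2)) := by
    intro k
    have h := ((Complex.continuous_re.tendsto _).comp (h1 k)).sub_const ((σ : ℝ) ^ 2)
    rw [Complex.ofReal_re, add_sub_cancel_right] at h
    refine h.congr fun N => ?_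
    have e : ∀ z : ℂ, z * star z = ((‖z‖ ^ 2 : ℝ) : ℂ) := fun z => by
      push_cast
      exact Complex.mul_conj' z
    simp only [powerEst, Function.comp, e, ← Complex.ofReal_sum]
    rw [← Complex.ofReal_natCast, ← Complex.ofReal_inv, ← Complex.ofReal_mul, Complex.ofReal_re]
  refine ⟨hp, fun m hm => tendsto_pi_nhds.mpr fun k₁ => tendsto_pi_nhds.mpr fun k₂ => ?_⟩
  -- The bias correction removes the diagonal term that depends on k. What remains is σ⁴ I, which
  -- does not affect eigenvectors.
  have hd : Tendsto (fun N => (diagonal fun k => (((σ : ℝ) ^ 2 *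
      (powerEst σ N (fun i => observation θ (X i ω)) k +
        powerEst σ N (fun i => observation θ (X i ω)) (k + m)) : ℝ) : ℂ)) k₁ k₂) atTop
      (𝓝 (if k₁ = k₂ then (((σ : ℝ) ^ 2 * (lam * ‖dft θ k₁‖ ^ 2 + lam * ‖dft θ (k₁ + m)‖ ^ 2) : ℝ)
        : ℂ) else 0)) := by
    simp only [Matrix.diagonal_apply]
    split_ifs
    · exact (Complex.continuous_ofReal.tendsto _).comp (((hp k₁).add (hp (k₁ + m))).const_mul _)
    · exact tendsto_const_nhds
  have h := (h2 m hm k₁ k₂).sub hd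
  refine (h.congr fun N => ?_).trans_eq ?_
  · simp [strideCov, Matrix.sum_apply, vecMulVec_apply]
  · congr 1
    simp only [Matrix.add_apply, Matrix.smul_apply, vecMulVec_apply, Matrix.one_apply, smul_eq_mul,
      Pi.star_apply]
    split_ifs <;> push_cast <;> ring

end Consistency

/-! ### Almost surely the circulant eigenvalues have distinct moduli -/

section NoTies

/-- Fubini: integrating over coordinate i first, every section is countable and hence null for an
atomless measure. -/
lemma ae_pi_notMem_of_forall_countable {ι : Type*} [Fintype ι] [DecidableEq ι]
    (ν : ι → Measure ℝ) [∀ i, SigmaFinite (ν i)] [∀ i, NullSingletonClass (ν i)]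
    {S : Set (ι → ℝ)} (hS : MeasurableSet S) (i : ι)
    (h : ∀ φ, {t : ℝ | Function.update φ i t ∈ S}.Countable) :
    ∀ᵐ φ ∂(Measure.pi ν), φ ∉ S := by
  rw [← measure_eq_zero_iff_ae_notMem]
  have hf : Measurable (S.indicator (1 : (ι → ℝ) → ENNReal)) := measurable_one.indicator hS
  rw [← lintegral_indicator_one hS, lintegral_eq_lmarginal_univ (fun _ => 0),
    lmarginal_erase' _ hf (Finset.mem_univ i)]
  have h0 : (fun φ : ι → ℝ => ∫⁻ t, S.indicator (1 : (ι → ℝ) → ENNReal) (Function.update φ i t)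
      ∂(ν i)) = fun _ => 0 := by
    funext φ
    have e : (fun t => S.indicator (1 : (ι → ℝ) → ENNReal) (Function.update φ i t))
        = {t : ℝ | Function.update φ i t ∈ S}.indicator 1 := by
      ext t
      simp [Set.indicator]
    rw [e, lintegral_indicator_one (h φ).measurableSet, (h φ).measure_zero]
  rw [h0]
  simp [lmarginal]

lemma countable_exp_eq {ζ : ℂ} (hζ : ζ ≠ 0) (w : ℂ) :
    {t : ℝ | ζ * star (Complex.exp (2 * Real.pi * Complex.I * t)) = w}.Countable := by
  rcases Set.eq_empty_or_nonempty
    {t : ℝ | ζ * star (Complex.exp (2 * Real.pi * Complex.I * t)) = w} with h | ⟨t₀, ht₀⟩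
  · rw [h]
    exact Set.countable_empty
  refine (Set.countable_range fun n : ℤ => t₀ + n).mono fun t ht => ?_
  have h1 : Complex.exp (2 * Real.pi * Complex.I * t)
      = Complex.exp (2 * Real.pi * Complex.I * t₀) :=
    star_injective (mul_left_cancel₀ hζ ((show _ = w from ht).trans (Eq.symm ht₀)))
  obtain ⟨n, hn⟩ := Complex.exp_eq_exp_iff_exists_int.mp h1
  refine ⟨n, ?_⟩
  have h2 : (2 * Real.pi * Complex.I) * (t : ℂ) = (2 * Real.pi * Complex.I) * ((t₀ + n : ℝ) : ℂ) := by
    push_cast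
    linear_combination hn
  exact (Complex.ofReal_injective (mul_left_cancel₀ Complex.two_pi_I_ne_zero h2)).symm

/-- The unit circle meets the perpendicular bisector of -a and -b in at most two points. Multiplying
|x+a|² = |x+b|² by x and using x x* = 1 gives a quadratic in x with constant term a - b ≠ 0. -/
lemma finite_unit_norm_add_eq {a b : ℂ} (h : a ≠ b) :
    {x : ℂ | ‖x‖ = 1 ∧ ‖x + a‖ = ‖x + b‖}.Finite := by
  let p : Polynomial ℂ := Polynomial.C (star (a - b)) * Polynomial.X ^ 2
    + Polynomial.C (a * star a - b * star b) * Polynomial.X + Polynomial.C (a - b)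
  have hp : p ≠ 0 := by
    intro h0
    have := congrArg (fun q => Polynomial.coeff q 0) h0
    simp [p, sub_eq_zero, h] at this
  refine (Polynomial.finite_setOfPred_isRoot hp).subset fun x ⟨hx, hn⟩ => ?_
  have e : ∀ z : ℂ, (‖z‖ : ℂ) ^ 2 = z * star z := fun z => (Complex.mul_conj' z).symm
  have hx' : x * star x = 1 := by rw [← e, hx]; simp
  have hn' : (x + a) * star (x + a) = (x + b) * star (x + b) := by rw [← e, ← e, hn]
  simp only [star_add] at hn'
  simp only [Set.mem_ofPred_eq, Polynomial.IsRoot, p, Polynomial.eval_add, Polynomial.eval_mul,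
    Polynomial.eval_C, Polynomial.eval_pow, Polynomial.eval_X, star_sub]
  linear_combination x * hn' - (a - b) * hx'

variable {L : ℕ} [NeZero L]

/-- The eigenvalue of the circulant matrix with the phases `ζ` and initial phases `φ`. -/
def phaseSum (ζ : ZMod L → ℂ) (φ : ZMod L → ℝ) (k : ZMod L) : ℂ :=
  ∑ m, ζ m * star (Complex.exp (2 * Real.pi * Complex.I * (φ m : ℂ))) * ZMod.stdAddChar (k * m)

lemma continuous_phaseSum (ζ : ZMod L → ℂ) (k : ZMod L) :
    Continuous fun φ => phaseSum ζ φ k := by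
  unfold phaseSum
  fun_prop

lemma phaseSum_update (ζ : ZMod L → ℂ) (φ : ZMod L → ℝ) (i : ZMod L) (t : ℝ) (k : ZMod L) :
    phaseSum ζ (Function.update φ i t) k
      = ζ i * star (Complex.exp (2 * Real.pi * Complex.I * t)) * ZMod.stdAddChar (k * i)
        + ∑ m ∈ Finset.univ.erase i,
          ζ m * star (Complex.exp (2 * Real.pi * Complex.I * (φ m : ℂ))) *
            ZMod.stdAddChar (k * m) := by
  rw [phaseSum, ← Finset.add_sum_erase _ _ (Finset.mem_univ i), Function.update_self]
  congr 1
  refine Finset.sum_congr rfl fun m hm => ?_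
  rw [Function.update_of_ne (Finset.ne_of_mem_erase hm)]

lemma ae_phaseSum_ne (ζ : ZMod L → ℂ) (hζ : ∀ m, ‖ζ m‖ = 1) {k k' : ZMod L} (hk : k ≠ k') :
    ∀ᵐ φ ∂(initialPhaseLaw L), phaseSum ζ φ k ≠ phaseSum ζ φ k' := by
  have hζ0 : ∀ m, ζ m ≠ 0 := fun m h => by simpa [h] using hζ m
  -- Coordinate 1 is varied: its coefficient in the difference is ζ[1] (χ(k) - χ(k')) up to a unit
  -- factor, which is nonzero as χ is injective.
  refine ae_pi_notMem_of_forall_countable _ (S := {φ | phaseSum ζ φ k = phaseSum ζ φ k'})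
    ?_ 1 fun φ => ?_
  · exact (isClosed_eq (continuous_phaseSum ζ k) (continuous_phaseSum ζ k')).measurableSet
  · simp only [Set.mem_ofPred_eq, phaseSum_update, mul_one]
    have he : (ZMod.stdAddChar k : ℂ) - ZMod.stdAddChar k' ≠ 0 :=
      sub_ne_zero.mpr fun h => hk (ZMod.injective_stdAddChar h)
    set a := ∑ m ∈ Finset.univ.erase 1,
          ζ m * star (Complex.exp (2 * Real.pi * Complex.I * (φ m : ℂ))) *
            ZMod.stdAddChar (k * m)
    set b := ∑ m ∈ Finset.univ.erase 1,
          ζ m * star (Complex.exp (2 * Real.pi * Complex.I * (φ m : ℂ))) *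
            ZMod.stdAddChar (k' * m)
    refine (countable_exp_eq (mul_ne_zero (hζ0 1) he) (b - a)).mono fun t ht => ?_
    simp only [Set.mem_ofPred_eq] at ht ⊢
    linear_combination ht

lemma ae_norm_phaseSum_ne (ζ : ZMod L → ℂ) (hζ : ∀ m, ‖ζ m‖ = 1) {k k' : ZMod L} (hk : k ≠ k') :
    ∀ᵐ φ ∂(initialPhaseLaw L), ‖phaseSum ζ φ k‖ ≠ ‖phaseSum ζ φ k'‖ := by
  have hζ0 : ∀ m, ζ m ≠ 0 := fun m h => by simpa [h] using hζ m
  have h : ∀ᵐ φ ∂(initialPhaseLaw L),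
      ¬ (phaseSum ζ φ k ≠ phaseSum ζ φ k' ∧ ‖phaseSum ζ φ k‖ = ‖phaseSum ζ φ k'‖) := by
    -- Coordinate 0 is varied: its summand x is the same for k and k', so a tie reads |x + a| = |x +
    -- b| with |x| = 1. The event excludes equal sums, which forces a ≠ b.
    refine ae_pi_notMem_of_forall_countable _
      (S := {φ | phaseSum ζ φ k ≠ phaseSum ζ φ k' ∧ ‖phaseSum ζ φ k‖ = ‖phaseSum ζ φ k'‖})
      ?_ 0 fun φ => ?_
    · exact ((isClosed_eq (continuous_phaseSum ζ k) (continuous_phaseSum ζ k')).measurableSet.compl).inter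
        (isClosed_eq (continuous_phaseSum ζ k).norm (continuous_phaseSum ζ k').norm).measurableSet
    · simp only [Set.mem_ofPred_eq, phaseSum_update, mul_zero,
        AddChar.map_zero_eq_one, mul_one]
      set a := ∑ m ∈ Finset.univ.erase 0,
          ζ m * star (Complex.exp (2 * Real.pi * Complex.I * (φ m : ℂ))) *
            ZMod.stdAddChar (k * m)
      set b := ∑ m ∈ Finset.univ.erase 0,
          ζ m * star (Complex.exp (2 * Real.pi * Complex.I * (φ m : ℂ))) *
            ZMod.stdAddChar (k' * m)
      by_cases hab : a = b
      · simp [hab]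
      refine ((finite_unit_norm_add_eq hab).countable.biUnion
        fun w _ => countable_exp_eq (hζ0 0) w).mono fun t ht => ?_
      simp only [Set.mem_iUnion]
      refine ⟨_, ⟨?_, ht.2⟩, rfl⟩
      rw [norm_mul, hζ, norm_star, Complex.norm_exp]
      simp
  filter_upwards [h, ae_phaseSum_ne ζ hζ hk] with φ h1 h2 h3
  exact h1 ⟨h2, h3⟩

/-- The roots ζ that arise depend on the sample and on the choices, so the null set must serve all
of them; there are only finitely many. -/
lemma ae_forall_norm_phaseSum_ne :
    ∀ᵐ φ ∂(initialPhaseLaw L), ∀ ζ : ZMod L → ℂ, (∀ m, ζ m ^ L = 1) →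
      ∀ k k', k ≠ k' → ‖phaseSum ζ φ k‖ ≠ ‖phaseSum ζ φ k'‖ := by
  have h : ∀ᵐ φ ∂(initialPhaseLaw L), ∀ ζ : ZMod L → rootsOfUnity L ℂ,
      ∀ k k', k ≠ k' → ‖phaseSum (fun m => ((ζ m : ℂˣ) : ℂ)) φ k‖
        ≠ ‖phaseSum (fun m => ((ζ m : ℂˣ) : ℂ)) φ k'‖ := by
    refine ae_all_iff.mpr fun ζ => ae_all_iff.mpr fun k => ae_all_iff.mpr fun k' =>
      ae_all_iff.mpr fun hk => ae_norm_phaseSum_ne _ (fun m => ?_) hk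
    exact Complex.norm_eq_one_of_pow_eq_one ((mem_rootsOfUnity' L _).mp (ζ m).2) (NeZero.ne L)
  filter_upwards [h] with φ hφ ζ hζ
  exact hφ fun m => rootsOfUnity.mkOfPowEq (ζ m) (hζ m)

end NoTies

/-! ### Variational characterizations of eigenvectors and singular vectors -/

section Extremal

open scoped ComplexOrder

variable {L : ℕ} [NeZero L]

lemma posSemidef_smul_one_sub {A : Matrix (ZMod L) (ZMod L) ℂ} (hA : A.IsHermitian) {c : ℝ}
    (h : ∀ (ev : ℝ) (x : ZMod L → ℂ), l2norm x = 1 → A *ᵥ x = (ev : ℂ) • x → ev ≤ c) :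
    ((c : ℂ) • (1 : Matrix (ZMod L) (ZMod L) ℂ) - A).PosSemidef := by
  have hB : ((c : ℂ) • (1 : Matrix (ZMod L) (ZMod L) ℂ) - A).IsHermitian := by
    refine Matrix.IsHermitian.sub ?_ hA
    rw [Matrix.IsHermitian, Matrix.conjTranspose_smul, Matrix.conjTranspose_one]
    simp
  rw [hB.posSemidef_iff_eigenvalues_nonneg]
  intro i
  have h1 := hB.mulVec_eigenvectorBasis i
  have h2 : l2norm ((hB.eigenvectorBasis i).ofLp) = 1 := by
    rw [l2norm, WithLp.toLp_ofLp]
    exact hB.eigenvectorBasis.orthonormal.1 i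
  have h3 := h (c - hB.eigenvalues i) _ h2 (by
    rw [Matrix.sub_mulVec, Matrix.smul_mulVec, Matrix.one_mulVec] at h1
    push_cast
    rw [sub_smul, eq_sub_iff_add_eq, add_comm, ← eq_sub_iff_add_eq]
    exact h1.symm)
  simpa using h3

lemma re_star_dotProduct_mulVec_le {A : Matrix (ZMod L) (ZMod L) ℂ} {c : ℝ}
    (h : ((c : ℂ) • (1 : Matrix (ZMod L) (ZMod L) ℂ) - A).PosSemidef) (x : ZMod L → ℂ) :
    (star x ⬝ᵥ A *ᵥ x).re ≤ c * ∑ k, ‖x k‖ ^ 2 := by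
  have h1 := h.re_dotProduct_nonneg x
  rw [Matrix.sub_mulVec, Matrix.smul_mulVec, Matrix.one_mulVec, dotProduct_sub, dotProduct_smul,
    star_dotProduct_self, smul_eq_mul, ← Complex.ofReal_mul] at h1
  change 0 ≤ (((c * ∑ k, ‖x k‖ ^ 2 : ℝ) : ℂ) - star x ⬝ᵥ A *ᵥ x).re at h1
  rw [Complex.sub_re, Complex.ofReal_re] at h1
  linarith

/-- Maximality among eigenvalues becomes a Rayleigh inequality against every unit vector, a form
that passes to limits of matrices. -/
lemma IsLeadingEigenvector.re_le {A : Matrix (ZMod L) (ZMod L) ℂ} (hA : A.IsHermitian)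
    {w : ZMod L → ℂ} (hw : IsLeadingEigenvector A w) {x : ZMod L → ℂ} (hx : l2norm x = 1) :
    (star x ⬝ᵥ A *ᵥ x).re ≤ (star w ⬝ᵥ A *ᵥ w).re := by
  obtain ⟨hw1, ev, hev, hmax⟩ := hw
  have hpos : ((ev : ℂ) • (1 : Matrix (ZMod L) (ZMod L) ℂ) - A).PosSemidef :=
    posSemidef_smul_one_sub hA fun ev' y hy he =>
      hmax ev' y (by rintro rfl; simp [l2norm] at hy) he
  have h := re_star_dotProduct_mulVec_le hpos x
  rw [(l2norm_eq_one_iff x).mp hx] at h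
  rw [hev, dotProduct_smul, star_dotProduct_self, (l2norm_eq_one_iff w).mp hw1]
  simpa using h

lemma star_mulVec_dotProduct_mulVec (M : Matrix (ZMod L) (ZMod L) ℂ) (x : ZMod L → ℂ) :
    star x ⬝ᵥ (Mᴴ * M) *ᵥ x = ((∑ k, ‖(M *ᵥ x) k‖ ^ 2 : ℝ) : ℂ) := by
  rw [← star_dotProduct_self, Matrix.star_mulVec, ← Matrix.dotProduct_mulVec, Matrix.mulVec_mulVec]

lemma sum_norm_mulVec_sq_le_of_maximal {M : Matrix (ZMod L) (ZMod L) ℂ} {s : ℝ}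
    (hmax : ∀ (s' : ℝ) (v' w' : ZMod L → ℂ), IsSingularTriple M s' v' w' → s' ≤ s)
    (x : ZMod L → ℂ) : ∑ k, ‖(M *ᵥ x) k‖ ^ 2 ≤ s ^ 2 * ∑ k, ‖x k‖ ^ 2 := by
  have hpos : (((s ^ 2 : ℝ) : ℂ) • (1 : Matrix (ZMod L) (ZMod L) ℂ) - Mᴴ * M).PosSemidef := by
    refine posSemidef_smul_one_sub (Matrix.isHermitian_conjTranspose_mul_self M)
      fun ev y hy he => ?_
    rcases le_or_gt ev 0 with h0 | h0
    · exact h0.trans (sq_nonneg s)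
    have hev : ∑ k, ‖(M *ᵥ y) k‖ ^ 2 = ev := by
      have h1 := star_mulVec_dotProduct_mulVec M y
      rw [he, dotProduct_smul, star_dotProduct_self, (l2norm_eq_one_iff y).mp hy] at h1
      simpa using (Complex.ofReal_injective (by simpa using h1) : ev = _).symm
    have hq : ((Real.sqrt ev : ℝ) : ℂ) ≠ 0 := by
      exact_mod_cast (Real.sqrt_pos.mpr h0).ne'
    have hqq : ((Real.sqrt ev : ℝ) : ℂ) * ((Real.sqrt ev : ℝ) : ℂ) = ev := by
      exact_mod_cast Real.mul_self_sqrt h0.le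
    -- A positive eigenvalue of M*M with unit eigenvector y yields the singular triple (√ev, My/√ev,
    -- y).
    have hle := hmax (Real.sqrt ev) (((Real.sqrt ev : ℝ) : ℂ)⁻¹ • M *ᵥ y) y ⟨Real.sqrt_nonneg _, by
        rw [l2norm_eq_one_iff]
        simp only [Pi.smul_apply, smul_eq_mul, norm_mul, mul_pow, ← Finset.mul_sum, hev, norm_inv,
          Complex.norm_real, inv_pow, Real.norm_eq_abs, sq_abs, Real.sq_sqrt h0.le]
        exact inv_mul_cancel₀ h0.ne', hy, by rw [smul_smul, mul_inv_cancel₀ hq, one_smul], by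
        rw [Matrix.mulVec_smul, Matrix.mulVec_mulVec, he, smul_smul, ← hqq, inv_mul_cancel_left₀ hq]⟩
    calc ev = Real.sqrt ev ^ 2 := (Real.sq_sqrt h0.le).symm
      _ ≤ s ^ 2 := by gcongr
  have h := re_star_dotProduct_mulVec_le hpos x
  rwa [star_mulVec_dotProduct_mulVec, Complex.ofReal_re] at h

/-- On unit vectors the form equals c |⟨z, x⟩|² + d. Comparison with z/‖z‖ forces equality in
Cauchy–Schwarz. -/
lemma eq_smul_of_maximal_rankOne {c d : ℝ} (hc : 0 < c) {z w : ZMod L → ℂ} (hz : z ≠ 0)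
    (hw : l2norm w = 1)
    (hmax : ∀ x, l2norm x = 1 →
      (star x ⬝ᵥ ((c : ℂ) • vecMulVec z (star z) + (d : ℂ) • (1 : Matrix (ZMod L) (ZMod L) ℂ)) *ᵥ
          x).re
        ≤ (star w ⬝ᵥ ((c : ℂ) • vecMulVec z (star z) +
          (d : ℂ) • (1 : Matrix (ZMod L) (ZMod L) ℂ)) *ᵥ w).re) :
    ∃ a : ℂ, a ≠ 0 ∧ w = a • z := by
  have hform : ∀ x, l2norm x = 1 → (star x ⬝ᵥ ((c : ℂ) • vecMulVec z (star z) +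
      (d : ℂ) • (1 : Matrix (ZMod L) (ZMod L) ℂ)) *ᵥ x).re = c * ‖star z ⬝ᵥ x‖ ^ 2 + d := by
    intro x hx
    have h1 : star x ⬝ᵥ z = star (star z ⬝ᵥ x) := by
      rw [Matrix.star_dotProduct]
    rw [Matrix.add_mulVec, Matrix.smul_mulVec, Matrix.smul_mulVec, Matrix.one_mulVec,
      dotProduct_add, dotProduct_smul, dotProduct_smul, star_dotProduct_self,
      (l2norm_eq_one_iff x).mp hx, Matrix.vecMulVec_mulVec]
    simp only [dotProduct_smul, h1]
    have h2 : MulOpposite.op (star z ⬝ᵥ x) • star (star z ⬝ᵥ x) = ((‖star z ⬝ᵥ x‖ ^ 2 : ℝ) : ℂ) := by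
      push_cast
      exact Complex.conj_mul' _
    rw [h2]
    simp [-Complex.ofReal_pow]
  have hinner : ∀ x, star z ⬝ᵥ x = inner ℂ (WithLp.toLp 2 z) (WithLp.toLp 2 x) := by
    intro x
    rw [EuclideanSpace.inner_toLp_toLp, dotProduct_comm]
  have hz0 : 0 < l2norm z := by
    rw [l2norm, norm_pos_iff]
    simpa using hz
  have hzu : l2norm (((l2norm z)⁻¹ : ℂ) • z) = 1 := by
    rw [l2norm, WithLp.toLp_smul, norm_smul]
    change ‖((l2norm z)⁻¹ : ℂ)‖ * l2norm z = 1
    rw [norm_inv, Complex.norm_real, Real.norm_of_nonneg hz0.le, inv_mul_cancel₀ hz0.ne']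
  have h := hmax _ hzu
  rw [hform _ hzu, hform w hw, add_le_add_iff_right, mul_le_mul_iff_right₀ hc, hinner, hinner,
    WithLp.toLp_smul, inner_smul_right, inner_self_eq_norm_sq_to_K, norm_mul, norm_inv] at h
  have h' : l2norm z ^ 2 ≤ ‖inner ℂ (WithLp.toLp 2 z) (WithLp.toLp 2 w)‖ ^ 2 := by
    refine le_trans (le_of_eq ?_) h
    change _ = (‖(l2norm z : ℂ)‖⁻¹ * ‖((l2norm z : ℝ) : ℂ) ^ 2‖) ^ 2
    rw [norm_pow, Complex.norm_real, Real.norm_of_nonneg hz0.le]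
    field_simp
  have hle : l2norm z ≤ ‖inner ℂ (WithLp.toLp 2 z) (WithLp.toLp 2 w)‖ :=
    (pow_le_pow_iff_left₀ hz0.le (norm_nonneg _) two_ne_zero).mp h'
  have heq : ‖inner ℂ (WithLp.toLp 2 z) (WithLp.toLp 2 w)‖
      = ‖WithLp.toLp 2 z‖ * ‖WithLp.toLp 2 w‖ := by
    refine le_antisymm (norm_inner_le_norm _ _) ?_
    change l2norm z * l2norm w ≤ _
    rwa [hw, mul_one]
  obtain ⟨a, ha, he⟩ := (norm_inner_eq_norm_iff (by simpa using hz)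
    (by rw [← norm_pos_iff]; change 0 < l2norm w; rw [hw]; exact one_pos)).mp heq
  refine ⟨a, ha, ?_⟩
  have := congrArg WithLp.ofLp he
  simpa using this

end Extremal

/-! ### Ultrafilter limits of the corrected eigenvectors -/

section Limits

variable {L : ℕ} [NeZero L]

lemma continuous_l2norm : Continuous (l2norm (L := L)) := by
  unfold l2norm
  exact continuous_norm.comp (PiLp.continuous_toLp 2 _)

lemma isCompact_setOf_l2norm_eq_one : IsCompact {v : ZMod L → ℂ | l2norm v = 1} := by
  refine Metric.isCompact_of_isClosed_isBounded
    (isClosed_eq continuous_l2norm continuous_const) ?_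
  refine (Metric.isBounded_closedBall (x := (0 : ZMod L → ℂ)) (r := 1)).subset fun v hv => ?_
  rw [mem_closedBall_zero_iff, pi_norm_le_iff_of_nonneg zero_le_one]
  intro k
  have h1 : l2norm v = 1 := hv
  rw [← h1]
  exact PiLp.norm_apply_le (WithLp.toLp 2 v) k

/-- Compactness of the sphere; an ultrafilter replaces the successive extraction of subsequences. -/
lemma exists_tendsto_of_l2norm_eq_one {ι : Type*} (U : Ultrafilter ι) {f : ι → ZMod L → ℂ}
    (hf : ∀ i, l2norm (f i) = 1) : ∃ v, l2norm v = 1 ∧ Tendsto f U (𝓝 v) := by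
  obtain ⟨v, hv, h⟩ := isCompact_setOf_l2norm_eq_one.ultrafilter_le_nhds (U.map f)
    (by simp [hf])
  exact ⟨v, hv, h⟩

lemma tendsto_mulVec {ι : Type*} {l : Filter ι} {M : ι → Matrix (ZMod L) (ZMod L) ℂ}
    {M₀ : Matrix (ZMod L) (ZMod L) ℂ} {v : ι → ZMod L → ℂ} {v₀ : ZMod L → ℂ}
    (hM : Tendsto M l (𝓝 M₀)) (hv : Tendsto v l (𝓝 v₀)) :
    Tendsto (fun i => M i *ᵥ v i) l (𝓝 (M₀ *ᵥ v₀)) := by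
  refine tendsto_pi_nhds.mpr fun k => tendsto_finsetSum _ fun l _ => ?_
  exact (tendsto_pi_nhds.mp (tendsto_pi_nhds.mp hM k) l).mul (tendsto_pi_nhds.mp hv l)

lemma tendsto_star_dotProduct_mulVec_re {ι : Type*} {l : Filter ι}
    {M : ι → Matrix (ZMod L) (ZMod L) ℂ}
    {M₀ : Matrix (ZMod L) (ZMod L) ℂ} {v : ι → ZMod L → ℂ} {v₀ : ZMod L → ℂ}
    (hM : Tendsto M l (𝓝 M₀)) (hv : Tendsto v l (𝓝 v₀)) :
    Tendsto (fun i => (star (v i) ⬝ᵥ M i *ᵥ v i).re) l (𝓝 (star v₀ ⬝ᵥ M₀ *ᵥ v₀).re) := by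
  refine (Complex.continuous_re.tendsto _).comp (tendsto_finsetSum _ fun k _ => ?_)
  exact ((continuous_star.tendsto _).comp (tendsto_pi_nhds.mp hv k)).mul
    (tendsto_pi_nhds.mp (tendsto_mulVec hM hv) k)

/-- The phase `z / |z|` of a complex number. -/
def phase (z : ℂ) : ℂ := z / ((‖z‖ : ℝ) : ℂ)

lemma norm_phase {z : ℂ} (hz : z ≠ 0) : ‖phase z‖ = 1 := by
  simp [phase, hz]

lemma phase_mul (z w : ℂ) : phase (z * w) = phase z * phase w := by
  simp only [phase, norm_mul, Complex.ofReal_mul]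
  exact mul_div_mul_comm _ _ _ _

lemma phase_star (z : ℂ) : phase (star z) = star (phase z) := by
  simp [phase]

lemma phase_of_norm_eq_one {z : ℂ} (hz : ‖z‖ = 1) : phase z = z := by
  simp [phase, hz]

lemma phase_ofReal_of_pos {r : ℝ} (hr : 0 < r) : phase (r : ℂ) = 1 := by
  have : (r : ℂ) ≠ 0 := by exact_mod_cast hr.ne'
  simp [phase, abs_of_pos hr, this]

lemma norm_mul_phase (z : ℂ) : (‖z‖ : ℂ) * phase z = z := by
  rcases eq_or_ne z 0 with rfl | hz
  · simp
  · have : (‖z‖ : ℂ) ≠ 0 := by simpa using hz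
    rw [phase, mul_div_cancel₀ _ this]

lemma phase_mul_star_phase {z : ℂ} (hz : z ≠ 0) : phase z * star (phase z) = 1 := by
  have h : phase z * star (phase z) = (‖phase z‖ : ℂ) ^ 2 := Complex.mul_conj' _
  rw [h, norm_phase hz]
  simp

lemma prod_phase {ι : Type*} (s : Finset ι) (f : ι → ℂ) :
    ∏ k ∈ s, phase (f k) = phase (∏ k ∈ s, f k) := by
  simp only [phase, Finset.prod_div_distrib, norm_prod, Complex.ofReal_prod]

lemma tendsto_phase {ι : Type*} {l : Filter ι} {f : ι → ℂ} {z : ℂ} (hf : Tendsto f l (𝓝 z))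
    (hz : z ≠ 0) : Tendsto (fun i => phase (f i)) l (𝓝 (phase z)) :=
  hf.div ((Complex.continuous_ofReal.tendsto _).comp hf.norm) (by simpa using hz)

lemma isHermitian_strideCov (σ : ℝ≥0) (N : ℕ) (y : ℕ → ZMod L → ℂ) (m : ZMod L) :
    (strideCov σ N y m).IsHermitian := by
  refine Matrix.IsHermitian.sub ?_ ?_
  · rw [Matrix.IsHermitian, Matrix.conjTranspose_smul, Matrix.conjTranspose_sum]
    simp [Matrix.conjTranspose_vecMulVec]
  · rw [Matrix.isHermitian_diagonal_iff]
    intro k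
    exact Complex.conj_ofReal _

lemma l2norm_smul (c : ℂ) (v : ZMod L → ℂ) : l2norm (c • v) = ‖c‖ * l2norm v := by
  rw [l2norm, WithLp.toLp_smul, norm_smul]
  rfl

lemma IsLeadingEigenvector.smul {A : Matrix (ZMod L) (ZMod L) ℂ} {w : ZMod L → ℂ}
    (hw : IsLeadingEigenvector A w) {c : ℂ} (hc : ‖c‖ = 1) : IsLeadingEigenvector A (c • w) := by
  obtain ⟨h1, ev, h2, h3⟩ := hw
  exact ⟨by rw [l2norm_smul, hc, h1, one_mul], ev, by rw [Matrix.mulVec_smul, h2, smul_comm], h3⟩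

/-- The scalar by which `phaseCorrect j` multiplies the vector `w`. -/
def phaseFactor (j : ZMod L) (w : ZMod L → ℂ) : ℂ :=
  Complex.exp (-(Complex.I / L) * ((∑ l, Complex.arg (w l) : ℝ) : ℂ)) *
    Complex.exp (2 * Real.pi * Complex.I * (j.val : ℂ) / L)

lemma phaseCorrect_eq_smul (j : ZMod L) (w : ZMod L → ℂ) :
    phaseCorrect j w = phaseFactor j w • w := by
  ext k
  simp only [phaseCorrect, phaseFactor, Pi.smul_apply, smul_eq_mul]
  ring

lemma norm_phaseFactor (j : ZMod L) (w : ZMod L → ℂ) : ‖phaseFactor j w‖ = 1 := by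
  have e1 : -(Complex.I / L) * ((∑ l, Complex.arg (w l) : ℝ) : ℂ)
      = ((-(∑ l, Complex.arg (w l)) / L : ℝ) : ℂ) * Complex.I := by
    push_cast; ring
  have e2 : 2 * Real.pi * Complex.I * (j.val : ℂ) / L
      = ((2 * Real.pi * j.val / L : ℝ) : ℂ) * Complex.I := by
    push_cast; ring
  rw [phaseFactor, e1, e2, norm_mul, Complex.norm_exp_ofReal_mul_I, Complex.norm_exp_ofReal_mul_I,
    one_mul]

/-- The L-th power of the correcting factor cancels the sum of the arguments, and the root of unity
disappears. This is the only trace of the correction that the limit argument needs. -/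
lemma prod_phaseCorrect (j : ZMod L) (w : ZMod L → ℂ) :
    ∏ k, phaseCorrect j w k = ((∏ k, ‖phaseCorrect j w k‖ : ℝ) : ℂ) := by
  have hL : (L : ℂ) ≠ 0 := Nat.cast_ne_zero.mpr (NeZero.ne L)
  have hpow : phaseFactor j w ^ L = Complex.exp (-(Complex.I * ∑ l, (Complex.arg (w l) : ℂ))) := by
    rw [phaseFactor, mul_pow, ← Complex.exp_nat_mul, ← Complex.exp_nat_mul]
    have e1 : (L : ℂ) * (-(Complex.I / L) * ((∑ l, Complex.arg (w l) : ℝ) : ℂ))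
        = -(Complex.I * ∑ l, (Complex.arg (w l) : ℂ)) := by
      push_cast
      field_simp
    have e2 : (L : ℂ) * (2 * Real.pi * Complex.I * (j.val : ℂ) / L)
        = (j.val : ℕ) * (2 * Real.pi * Complex.I) := by
      field_simp
    rw [e1, e2, Complex.exp_nat_mul_two_pi_mul_I, mul_one]
  have hw : ∏ k, w k = (∏ k, (‖w k‖ : ℂ)) * Complex.exp (Complex.I * ∑ l, (Complex.arg (w l) : ℂ)) := by
    rw [Finset.mul_sum, Complex.exp_sum, ← Finset.prod_mul_distrib]
    refine Finset.prod_congr rfl fun k _ => ?_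
    rw [mul_comm Complex.I, Complex.norm_mul_exp_arg_mul_I]
  simp only [phaseCorrect_eq_smul, Pi.smul_apply, smul_eq_mul, norm_mul, norm_phaseFactor, one_mul,
    Finset.prod_mul_distrib, Finset.prod_const, Finset.card_univ, ZMod.card, hpow, hw,
    Complex.ofReal_prod]
  rw [mul_left_comm, ← Complex.exp_add]
  simp

lemma exists_phase_limit_of_leading {c d : ℝ} (hc : 0 < c) {θ : ZMod L → ℂ}
    (hθ : ∀ k, dft θ k ≠ 0) (m : ZMod L) (U : Ultrafilter ℕ)
    {A : ℕ → Matrix (ZMod L) (ZMod L) ℂ} (hA : ∀ N, (A N).IsHermitian)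
    (hlim : Tendsto A U (𝓝 ((c : ℂ) • vecMulVec (strideProd m θ) (star (strideProd m θ))
      + (d : ℂ) • (1 : Matrix (ZMod L) (ZMod L) ℂ))))
    {u : ℕ → ZMod L → ℂ} (hu : ∀ N, IsLeadingEigenvector (A N) (u N))
    (hprod : ∀ N, ∏ k, u N k = ((∏ k, ‖u N k‖ : ℝ) : ℂ)) :
    ∃ ζ : ℂ, ζ ^ L = 1 ∧ ∀ k, Tendsto (fun N => phase (u N k)) U
      (𝓝 (ζ * (phase (dft θ k) * star (phase (dft θ (k + m)))))) := by
  obtain ⟨v, hv, hlimu⟩ := exists_tendsto_of_l2norm_eq_one U fun N => (hu N).1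
  have hz : ∀ k, strideProd m θ k ≠ 0 := fun k =>
    mul_ne_zero (hθ k) (star_ne_zero.mpr (hθ (k + m)))
  have hz0 : strideProd m θ ≠ 0 := fun h => hz 0 (congrFun h 0)
  obtain ⟨a, ha, hva⟩ := eq_smul_of_maximal_rankOne hc hz0 hv fun x hx =>
    le_of_tendsto_of_tendsto (tendsto_star_dotProduct_mulVec_re hlim tendsto_const_nhds)
      (tendsto_star_dotProduct_mulVec_re hlim hlimu)
      (Eventually.of_forall fun N => (hu N).re_le (hA N) hx)
  have hvk : ∀ k, v k = a * strideProd m θ k := fun k => congrFun hva k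
  have hphase : ∀ k, phase (v k) = phase a * (phase (dft θ k) * star (phase (dft θ (k + m)))) := by
    intro k
    rw [hvk, phase_mul, strideProd, phase_mul, phase_star]
  have hv0 : ∀ k, v k ≠ 0 := fun k => by rw [hvk]; exact mul_ne_zero ha (hz k)
  refine ⟨phase a, ?_, fun k => ?_⟩
  · have hlimprod : ∏ k, v k = ((∏ k, ‖v k‖ : ℝ) : ℂ) := by
      have h1 : Tendsto (fun N => ∏ k, u N k) U (𝓝 (∏ k, v k)) :=
        tendsto_finsetProd _ fun k _ => (tendsto_pi_nhds.mp hlimu) k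
      have h2 : Tendsto (fun N => ((∏ k, ‖u N k‖ : ℝ) : ℂ)) U (𝓝 ((∏ k, ‖v k‖ : ℝ) : ℂ)) :=
        (Complex.continuous_ofReal.tendsto _).comp
          (tendsto_finsetProd _ fun k _ => ((tendsto_pi_nhds.mp hlimu) k).norm)
      exact tendsto_nhds_unique h1 (h2.congr fun N => (hprod N).symm)
    have h3 : ∏ k, phase (v k) = 1 := by
      rw [prod_phase, hlimprod]
      exact phase_ofReal_of_pos (Finset.prod_pos fun k _ => norm_pos_iff.mpr (hv0 k))
    simp only [hphase, Finset.prod_mul_distrib, Finset.prod_const, Finset.card_univ, ZMod.card] at h3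
    -- Reindexing by k ↦ k + m makes the phases of θ̂ cancel in the product, leaving (phase a)^L =
    -- 1.
    rw [Fintype.prod_equiv (Equiv.addRight m) (fun k => star (phase (dft θ (k + m))))
      (fun k => star (phase (dft θ k))) (fun k => rfl), ← Finset.prod_mul_distrib,
      Finset.prod_eq_one fun k _ => phase_mul_star_phase (hθ k), mul_one] at h3
    exact h3
  · rw [← hphase]
    exact tendsto_phase ((tendsto_pi_nhds.mp hlimu) k) (hv0 k)

end Limits

/-! ### Top singular vectors of the limiting circulant -/

section SingularVectors

variable {L : ℕ} [NeZero L]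

/-- The matrix `diag(P) Circul{γ} diag(P)*`. -/
def conjCircul (P γ : ZMod L → ℂ) : Matrix (ZMod L) (ZMod L) ℂ :=
  Matrix.of fun k₁ k₂ => P k₁ * star (P k₂) * γ (k₂ - k₁)

lemma conjCircul_mulVec (P γ x : ZMod L → ℂ) (k : ZMod L) :
    (conjCircul P γ *ᵥ x) k = P k * (circul γ *ᵥ fun l => star (P l) * x l) k := by
  simp only [conjCircul, circul, Matrix.mulVec, dotProduct, Matrix.of_apply, Finset.mul_sum]
  exact Finset.sum_congr rfl fun l _ => by ring

lemma sum_norm_conjCircul_mulVec_sq {P : ZMod L → ℂ} (hP : ∀ k, ‖P k‖ = 1) (γ x : ZMod L → ℂ) :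
    ∑ k, ‖(conjCircul P γ *ᵥ x) k‖ ^ 2
      = ∑ k, ‖∑ m, γ m * ZMod.stdAddChar (k * m)‖ ^ 2 * ‖dft (fun l => star (P l) * x l) k‖ ^ 2 := by
  simp only [conjCircul_mulVec, norm_mul, hP, one_mul]
  rw [← sum_norm_dft_sq]
  simp only [dft_circul_mulVec, norm_mul, mul_pow]

lemma sum_norm_dft_star_mul_sq {P : ZMod L → ℂ} (hP : ∀ k, ‖P k‖ = 1) (x : ZMod L → ℂ) :
    ∑ k, ‖dft (fun l => star (P l) * x l) k‖ ^ 2 = ∑ k, ‖x k‖ ^ 2 := by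
  rw [sum_norm_dft_sq]
  simp only [norm_mul, norm_star, hP, one_mul]

lemma apply_eq_of_dft_eq_zero {v : ZMod L → ℂ} {k₀ : ZMod L} (h : ∀ k, k ≠ k₀ → dft v k = 0)
    (l : ZMod L) :
    v l = ((Real.sqrt L : ℝ) : ℂ)⁻¹ * dft v k₀ * ZMod.stdAddChar (k₀ * l) := by
  have h1 := congrFun (conjTranspose_dftMatrix_mulVec_dft v) l
  rw [← h1, Matrix.mulVec, dotProduct, Finset.sum_eq_single k₀]
  · rw [Matrix.conjTranspose_apply, dftMatrix_apply, star_mul', star_stdAddChar, neg_neg]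
    have : star (((Real.sqrt L : ℝ) : ℂ)⁻¹) = ((Real.sqrt L : ℝ) : ℂ)⁻¹ := by simp
    rw [this]
    ring
  · intro k _ hk
    rw [h k hk, mul_zero]
  · simp

/-- The eigenvalues add up to L γ[0]. This makes the top singular value positive in the limit, so
that q has limiting phases. -/
lemma exists_sum_stdAddChar_ne_zero {γ : ZMod L → ℂ} (hγ : γ 0 ≠ 0) :
    ∃ k : ZMod L, ∑ m, γ m * ZMod.stdAddChar (k * m) ≠ 0 := by
  by_contra! h
  have h1 : ∑ k : ZMod L, ∑ m, γ m * (ZMod.stdAddChar (k * m) : ℂ) = 0 :=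
    Finset.sum_eq_zero fun k _ => h k
  rw [Finset.sum_comm] at h1
  simp only [mul_comm _ (_ : ZMod L), ← Finset.mul_sum, sum_stdAddChar_mul, mul_ite, mul_zero,
    Finset.sum_ite_eq', Finset.mem_univ, if_true] at h1
  exact (mul_ne_zero hγ (Nat.cast_ne_zero.mpr (NeZero.ne L))) h1

lemma exists_strict_maximizer {γ : ZMod L → ℂ}
    (hties : ∀ k k' : ZMod L, k ≠ k' → ‖∑ m, γ m * (ZMod.stdAddChar (k * m) : ℂ)‖
      ≠ ‖∑ m, γ m * (ZMod.stdAddChar (k' * m) : ℂ)‖) :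
    ∃ k₀ : ZMod L, ∀ k, k ≠ k₀ → ‖∑ m, γ m * (ZMod.stdAddChar (k * m) : ℂ)‖
      < ‖∑ m, γ m * (ZMod.stdAddChar (k₀ * m) : ℂ)‖ := by
  obtain ⟨k₀, hk₀⟩ := Finite.exists_max fun k : ZMod L =>
    ‖∑ m, γ m * (ZMod.stdAddChar (k * m) : ℂ)‖
  exact ⟨k₀, fun k hk => lt_of_le_of_ne (hk₀ k) (hties k k₀ hk)⟩

/-- A unit vector at which `diag(P) Circul{γ} diag(P)*` attains its operator norm is a modulated
Fourier vector of the dominant frequency, and an eigenvector. -/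
lemma eq_of_maximal_conjCircul {P γ w : ZMod L → ℂ} (hP : ∀ k, ‖P k‖ = 1) {k₀ : ZMod L}
    (hk₀ : ∀ k, k ≠ k₀ → ‖∑ m, γ m * (ZMod.stdAddChar (k * m) : ℂ)‖
      < ‖∑ m, γ m * (ZMod.stdAddChar (k₀ * m) : ℂ)‖)
    (hw : l2norm w = 1)
    (hmax : ∀ x, l2norm x = 1 →
      ∑ k, ‖(conjCircul P γ *ᵥ x) k‖ ^ 2 ≤ ∑ k, ‖(conjCircul P γ *ᵥ w) k‖ ^ 2) :
    (∃ c : ℂ, c ≠ 0 ∧ ∀ l, w l = c * (P l * ZMod.stdAddChar (k₀ * l))) ∧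
      conjCircul P γ *ᵥ w = (∑ m, γ m * (ZMod.stdAddChar (k₀ * m) : ℂ)) • w := by
  have hPs : ∀ k, P k * star (P k) = 1 := fun k => by
    have h : P k * star (P k) = (‖P k‖ : ℂ) ^ 2 := Complex.mul_conj' _
    rw [h, hP]; simp
  set S : ZMod L → ℂ := fun k => ∑ m, γ m * (ZMod.stdAddChar (k * m) : ℂ) with hS
  set a : ZMod L → ℂ := dft fun l => star (P l) * w l with ha
  have ha1 : ∑ k, ‖a k‖ ^ 2 = 1 := by
    rw [ha, sum_norm_dft_star_mul_sq hP, ← l2norm_eq_one_iff]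
    exact hw
  have hge : ‖S k₀‖ ^ 2 ≤ ∑ k, ‖S k‖ ^ 2 * ‖a k‖ ^ 2 := by
    -- The test vector is the modulated Fourier vector of frequency k₀, at which the value |S(k₀)|²
    -- is attained.
    set x : ZMod L → ℂ := fun l => P l * ((dftMatrix L)ᴴ *ᵥ Pi.single k₀ 1) l with hx
    have hdx : dft (fun l => star (P l) * x l) = Pi.single k₀ 1 := by
      have e : (fun l => star (P l) * x l) = (dftMatrix L)ᴴ *ᵥ Pi.single k₀ 1 := by
        ext l
        rw [hx, ← mul_assoc, mul_comm (star _), hPs, one_mul]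
      rw [e, dft, Matrix.mulVec_mulVec, dftMatrix_mul_conjTranspose, Matrix.one_mulVec]
    have hx1 : l2norm x = 1 := by
      rw [l2norm_eq_one_iff, ← sum_norm_dft_star_mul_sq hP, hdx]
      simp [Pi.single_apply, apply_ite]
    have h := hmax x hx1
    rw [sum_norm_conjCircul_mulVec_sq hP, sum_norm_conjCircul_mulVec_sq hP, hdx] at h
    refine le_trans (le_of_eq ?_) h
    simp [Pi.single_apply, apply_ite, hS]
  have hzero : ∀ k, k ≠ k₀ → a k = 0 := by
    intro k hk
    by_contra hak
    -- Any mass of w off the frequency k₀ would strictly lower the weighted average below |S(k₀)|².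
    have hlt : ∑ k, ‖S k‖ ^ 2 * ‖a k‖ ^ 2 < ∑ k, ‖S k₀‖ ^ 2 * ‖a k‖ ^ 2 := by
      refine Finset.sum_lt_sum (fun k' _ => ?_) ⟨k, Finset.mem_univ k, ?_⟩
      · rcases eq_or_ne k' k₀ with rfl | hk'
        · exact le_rfl
        · have := (hk₀ k' hk').le
          gcongr
      · have h1 := hk₀ k hk
        have h2 : 0 < ‖a k‖ ^ 2 := by positivity
        exact mul_lt_mul_of_pos_right
          (pow_lt_pow_left₀ h1 (norm_nonneg _) two_ne_zero) h2
    rw [← Finset.mul_sum, ha1, mul_one] at hlt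
    exact absurd hge (not_le.mpr hlt)
  have hv : ∀ l, w l = P l * (star (P l) * w l) := fun l => by rw [← mul_assoc, hPs, one_mul]
  have hak₀ : a k₀ ≠ 0 := by
    intro h0
    have : ∀ k, a k = 0 := fun k => by
      rcases eq_or_ne k k₀ with rfl | hk
      exacts [h0, hzero k hk]
    simp [this] at ha1
  refine ⟨⟨((Real.sqrt L : ℝ) : ℂ)⁻¹ * a k₀, mul_ne_zero (inv_ne_zero ?_) hak₀, fun l => ?_⟩, ?_⟩
  · have : 0 < Real.sqrt L := Real.sqrt_pos.mpr (Nat.cast_pos.mpr (NeZero.pos L))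
    exact_mod_cast this.ne'
  · rw [hv l, apply_eq_of_dft_eq_zero hzero l]
    ring
  · ext k
    have hc : circul γ *ᵥ (fun l => star (P l) * w l) = S k₀ • fun l => star (P l) * w l := by
      rw [← conjTranspose_dftMatrix_mulVec_dft (circul γ *ᵥ _),
        ← conjTranspose_dftMatrix_mulVec_dft (S k₀ • _)]
      congr 1
      ext k'
      rw [dft_circul_mulVec, dft_smul, Pi.smul_apply, smul_eq_mul]
      rcases eq_or_ne k' k₀ with rfl | hk'
      · rfl
      · have h0 := hzero k' hk'
        rw [ha] at h0
        rw [h0, mul_zero, mul_zero]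
    rw [conjCircul_mulVec, hc, Pi.smul_apply, Pi.smul_apply, smul_eq_mul, smul_eq_mul, mul_left_comm,
      ← hv]

lemma exists_phase_limit_of_qStep {P γ : ZMod L → ℂ} (hP : ∀ k, ‖P k‖ = 1) (hγ : γ 0 ≠ 0)
    {k₀ : ZMod L}
    (hk₀ : ∀ k, k ≠ k₀ → ‖∑ m, γ m * (ZMod.stdAddChar (k * m) : ℂ)‖
      < ‖∑ m, γ m * (ZMod.stdAddChar (k₀ * m) : ℂ)‖)
    (U : Ultrafilter ℕ) {M : ℕ → Matrix (ZMod L) (ZMod L) ℂ}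
    (hM : Tendsto M U (𝓝 (conjCircul P γ))) {q : ℕ → ZMod L → ℂ} (hq : ∀ N, IsQStep (M N) (q N)) :
    ∃ c : ℂ, ‖c‖ = 1 ∧
      ∀ l, Tendsto (fun N => phase (q N l)) U (𝓝 (c * (P l * ZMod.stdAddChar (k₀ * l)))) := by
  choose s v w htriple hmax hqeq using hq
  obtain ⟨w₀, hw₀, hlimw⟩ := exists_tendsto_of_l2norm_eq_one U fun N => (htriple N).2.2.1
  have hMw : Tendsto (fun N => M N *ᵥ w N) U (𝓝 (conjCircul P γ *ᵥ w₀)) := tendsto_mulVec hM hlimw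
  have hnorm : ∀ N, s N ^ 2 = ∑ k, ‖(M N *ᵥ w N) k‖ ^ 2 := by
    intro N
    obtain ⟨h0, hv, hw, h1, h2⟩ := htriple N
    rw [h1, ← l2norm_sq, l2norm_smul, hv, Complex.norm_real, mul_one, Real.norm_eq_abs, sq_abs]
  have hsum : ∀ {f : ℕ → ZMod L → ℂ} {f₀ : ZMod L → ℂ}, Tendsto f U (𝓝 f₀) →
      Tendsto (fun N => ∑ k, ‖f N k‖ ^ 2) U (𝓝 (∑ k, ‖f₀ k‖ ^ 2)) := fun hf =>
    tendsto_finsetSum _ fun k _ => ((tendsto_pi_nhds.mp hf k).norm.pow 2)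
  have hmax₀ : ∀ x, l2norm x = 1 →
      ∑ k, ‖(conjCircul P γ *ᵥ x) k‖ ^ 2 ≤ ∑ k, ‖(conjCircul P γ *ᵥ w₀) k‖ ^ 2 := by
    intro x hx
    refine le_of_tendsto_of_tendsto (hsum (tendsto_mulVec hM tendsto_const_nhds)) (hsum hMw)
      (Eventually.of_forall fun N => ?_)
    have h := sum_norm_mulVec_sq_le_of_maximal (hmax N) x
    rw [(l2norm_eq_one_iff x).mp hx, mul_one, hnorm N] at h
    exact h
  obtain ⟨⟨c, hc0, hc⟩, heig⟩ := eq_of_maximal_conjCircul hP hk₀ hw₀ hmax₀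
  set S₀ := ∑ m, γ m * (ZMod.stdAddChar (k₀ * m) : ℂ) with hS₀
  have hS₀ne : S₀ ≠ 0 := by
    obtain ⟨k, hk⟩ := exists_sum_stdAddChar_ne_zero hγ
    rcases eq_or_ne k k₀ with rfl | hne
    · exact hk
    · exact norm_pos_iff.mp ((norm_nonneg _).trans_lt (hk₀ k hne))
  have hs : Tendsto s U (𝓝 ‖S₀‖) := by
    have h1 := (Real.continuous_sqrt.tendsto _).comp (hsum hMw)
    rw [heig, ← l2norm_sq, l2norm_smul, hw₀, mul_one, Real.sqrt_sq (norm_nonneg _)] at h1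
    refine h1.congr fun N => ?_
    simp only [Function.comp]
    rw [← hnorm, Real.sqrt_sq (htriple N).1]
  have hlim : ∀ b : ℂ, b ≠ 0 → Tendsto q U (𝓝 (b • w₀)) →
      ∃ c : ℂ, ‖c‖ = 1 ∧
        ∀ l, Tendsto (fun N => phase (q N l)) U (𝓝 (c * (P l * ZMod.stdAddChar (k₀ * l)))) := by
    intro b hb hqb
    refine ⟨phase (b * c), norm_phase (mul_ne_zero hb hc0), fun l => ?_⟩
    have hnorml : ‖P l * ZMod.stdAddChar (k₀ * l)‖ = 1 := by
      rw [norm_mul, hP, norm_stdAddChar, one_mul]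
    have e : (b • w₀) l = b * c * (P l * ZMod.stdAddChar (k₀ * l)) := by
      rw [Pi.smul_apply, smul_eq_mul, hc l, mul_assoc]
    have h := tendsto_phase (tendsto_pi_nhds.mp hqb l) (by
      rw [e]
      exact mul_ne_zero (mul_ne_zero hb hc0) (norm_pos_iff.mp (by rw [hnorml]; exact one_pos)))
    rwa [e, phase_mul, phase_of_norm_eq_one hnorml] at h
  -- The choice of a left or right vector may change with N, but an ultrafilter selects one. In the
  -- limit s v = M w tends to S₀ w₀ and s w to |S₀| w₀, both nonzero multiples of w₀.
  rcases Ultrafilter.eventually_or.mp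
    (Eventually.of_forall (f := (U : Filter ℕ)) hqeq) with h | h
  · refine hlim S₀ hS₀ne ?_
    rw [← heig]
    refine hMw.congr' (h.mono fun N hN => ?_)
    rw [hN, (htriple N).2.2.2.1]
  · refine hlim (‖S₀‖ : ℂ) (by simpa using hS₀ne) ?_
    have h1 : Tendsto (fun N => (s N : ℂ) • w N) U (𝓝 ((‖S₀‖ : ℂ) • w₀)) :=
      ((Complex.continuous_ofReal.tendsto _).comp hs).smul hlimw
    exact h1.congr' (h.mono fun N hN => hN.symm)

end SingularVectors

/-! ### Recovery of the signal up to phase and shift -/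

section Recovery

lemma shift_limit_eq {L : ℕ} {θ : ZMod L → ℂ} {c : ℂ} (hc : ‖c‖ = 1) (k₀ : ZMod L) :
    θ - star c • shift k₀ (c • shift (-k₀) θ) = 0 := by
  have h : star c * c = 1 := by
    have e : star c * c = (‖c‖ : ℂ) ^ 2 := Complex.conj_mul' _
    rw [e, hc]; simp
  rw [shift_smul, shift_shift, add_neg_cancel, shift_zero, smul_smul, h, one_smul, sub_self]

variable {L : ℕ} [NeZero L]

lemma tendsto_magnitudeEst {ι : Type*} {l : Filter ι} {θ : ZMod L → ℂ} (hθ : l2norm θ = 1)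
    {lam σ : ℝ≥0} (hlam : 0 < lam) {y : ℕ → ZMod L → ℂ} {n : ι → ℕ}
    (hpow : ∀ k, Tendsto (fun i => powerEst σ (n i) y k) l (𝓝 (lam * ‖dft θ k‖ ^ 2)))
    (k : ZMod L) : Tendsto (fun i => magnitudeEst σ (n i) y k) l (𝓝 ‖dft θ k‖) := by
  have hlam' : (0 : ℝ) < lam := by exact_mod_cast hlam
  have hsum : Tendsto (fun i => lamEst σ (n i) y) l (𝓝 lam) := by
    have h := tendsto_finsetSum Finset.univ fun k _ => (hpow k).abs
    have e : ∑ k, |(lam : ℝ) * ‖dft θ k‖ ^ 2| = lam := by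
      simp only [abs_mul, abs_pow, abs_norm, NNReal.abs_eq, ← Finset.mul_sum]
      rw [sum_norm_dft_sq, (l2norm_eq_one_iff θ).mp hθ, mul_one]
    rwa [e] at h
  have h := (Real.continuous_sqrt.tendsto _).comp ((hpow k).div hsum hlam'.ne')
  rwa [mul_div_cancel_left₀ _ hlam'.ne', Real.sqrt_sq (norm_nonneg _)] at h

lemma AMRun.u_spec {σ : ℝ≥0} {τ N : ℕ} {y : ℕ → ZMod L → ℂ} {φ : ZMod L → ℝ}
    (r : AMRun σ τ N y φ) {m : ZMod L} (hm : m ≠ 0) :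
    IsLeadingEigenvector (strideCov σ N y m) (r.u m) := by
  rw [AMRun.u, phaseCorrect_eq_smul]
  exact (r.w_spec m hm).smul (norm_phaseFactor _ _)

/-- Besides the limit of the estimate, the conclusion records how the phases at entry 0 determine ζ
and c, and ζ determines k₀; these facts let different ultrafilters be compared. -/
lemma exists_limit_of_runs {θ : ZMod L → ℂ} (hθ : l2norm θ = 1) (hθhat : ∀ k, 0 < ‖dft θ k‖)
    {lam σ : ℝ≥0} (hlam : 0 < lam) {y : ℕ → ZMod L → ℂ} {φ : ZMod L → ℝ}
    (hpow : ∀ k, Tendsto (fun N => powerEst σ N y k) atTop (𝓝 (lam * ‖dft θ k‖ ^ 2)))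
    (hcov : ∀ m : ZMod L, m ≠ 0 → Tendsto (fun N => strideCov σ N y m) atTop
      (𝓝 ((2 * ((lam : ℝ) : ℂ) ^ 2) • vecMulVec (strideProd m θ) (star (strideProd m θ))
        + (((σ : ℝ) ^ 4 : ℝ) : ℂ) • (1 : Matrix (ZMod L) (ZMod L) ℂ))))
    (hties : ∀ ζ : ZMod L → ℂ, (∀ m, ζ m ^ L = 1) →
      ∀ k k', k ≠ k' → ‖phaseSum ζ φ k‖ ≠ ‖phaseSum ζ φ k'‖)
    (run : ∀ N : ℕ, AMRun σ 1 N y φ) (U : Ultrafilter ℕ) (hU : (U : Filter ℕ) ≤ atTop) :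
    ∃ (ζ : ZMod L → ℂ) (k₀ : ZMod L) (c : ℂ), ζ 0 = 1 ∧
      (∀ m, m ≠ 0 → Tendsto (fun N => phase ((run N).u m 0)) U
        (𝓝 (ζ m * (phase (dft θ 0) * star (phase (dft θ m)))))) ∧
      (∀ k, k ≠ k₀ → ‖phaseSum ζ φ k‖ < ‖phaseSum ζ φ k₀‖) ∧ ‖c‖ = 1 ∧
      Tendsto (fun N => phase ((run N).q 1 0)) U (𝓝 (c * phase (dft θ 0))) ∧
      Tendsto (fun N => (run N).estimate) U (𝓝 (c • shift (-k₀) θ)) := by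
  have hθ0 : ∀ k, dft θ k ≠ 0 := fun k => norm_pos_iff.mp (hθhat k)
  have hlam' : (0 : ℝ) < lam := by exact_mod_cast hlam
  -- The value 1 at m = 0 matches the unit diagonal of C̃_x.
  have hex : ∀ m : ZMod L, ∃ ζ : ℂ, ζ ^ L = 1 ∧ (m = 0 → ζ = 1) ∧ (m ≠ 0 → ∀ k,
      Tendsto (fun N => phase ((run N).u m k)) U
        (𝓝 (ζ * (phase (dft θ k) * star (phase (dft θ (k + m))))))) := by
    intro m
    rcases eq_or_ne m 0 with hm | hm
    · exact ⟨1, one_pow _, fun _ => rfl, fun h => absurd hm h⟩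
    · have hlim := (hcov m hm).mono_left hU
      have e : (2 * ((lam : ℝ) : ℂ) ^ 2) = ((2 * (lam : ℝ) ^ 2 : ℝ) : ℂ) := by push_cast; rfl
      rw [e] at hlim
      obtain ⟨ζ, h1, h2⟩ := exists_phase_limit_of_leading (by positivity) hθ0 m U
        (fun N => isHermitian_strideCov σ N y m) hlim (fun N => (run N).u_spec hm)
        (fun N => prod_phaseCorrect _ _)
      exact ⟨ζ, h1, fun h => absurd h hm, fun _ => h2⟩
  choose ζ hζ hζ0 hlimu using hex
  have hPhase : ∀ k, ‖phase (dft θ k)‖ = 1 := fun k => norm_phase (hθ0 k)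
  set γ : ZMod L → ℂ := fun m => ζ m * star (Complex.exp (2 * Real.pi * Complex.I * (φ m : ℂ)))
    with hγ
  obtain ⟨k₀, hk₀⟩ := exists_strict_maximizer (γ := γ) (hties ζ hζ)
  have hγ0 : γ 0 ≠ 0 := by
    simp only [hγ, hζ0 0 rfl, one_mul]
    exact star_ne_zero.mpr (Complex.exp_ne_zero _)
  have hM : Tendsto (fun N => phaseMatrix (fun m => phaseCorrect ((run N).j m) ((run N).w m)) ⊙
      circul (star ((run N).α 0))) U (𝓝 (conjCircul (fun k => phase (dft θ k)) γ)) := by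
    refine tendsto_pi_nhds.mpr fun k₁ => tendsto_pi_nhds.mpr fun k₂ => ?_
    have hα : ∀ N m, (run N).α 0 m = Complex.exp (2 * Real.pi * Complex.I * (φ m : ℂ)) :=
      fun N m => (run N).α_init m
    simp only [Matrix.hadamard_apply, circul, phaseMatrix, Matrix.of_apply, Pi.star_apply, hα,
      conjCircul, hγ]
    have h : Tendsto (fun N => if k₁ = k₂ then (1 : ℂ) else
        phase ((run N).u (k₂ - k₁) k₁)) U
        (𝓝 (ζ (k₂ - k₁) * (phase (dft θ k₁) * star (phase (dft θ k₂))))) := by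
      split_ifs with hk
      · subst hk
        rw [sub_self, hζ0 0 rfl, one_mul, phase_mul_star_phase (hθ0 k₁)]
        exact tendsto_const_nhds
      · have h := hlimu (k₂ - k₁) (sub_ne_zero.mpr (Ne.symm hk)) k₁
        rwa [add_sub_cancel] at h
    have h2 := h.mul_const (star (Complex.exp (2 * Real.pi * Complex.I * (φ (k₂ - k₁) : ℂ))))
    convert! h2 using 2
    ring
  obtain ⟨c, hc, hq⟩ := exists_phase_limit_of_qStep hPhase hγ0 hk₀ U hM
    fun N => (run N).q_step 0 one_pos
  refine ⟨ζ, k₀, c, hζ0 0 rfl, fun m hm => ?_, hk₀, hc, ?_, ?_⟩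
  · simpa using hlimu m hm 0
  · simpa using hq 0
  · have hlim : Tendsto (fun N => fun k => phase ((run N).q 1 k) * (magnitudeEst σ N y k : ℂ)) U
        (𝓝 (dft (c • shift (-k₀) θ))) := by
      refine tendsto_pi_nhds.mpr fun k => ?_
      have h := (hq k).mul ((Complex.continuous_ofReal.tendsto _).comp
        (tendsto_magnitudeEst hθ hlam (fun k => (hpow k).mono_left hU) k))
      refine h.trans_eq ?_
      rw [dft_smul, Pi.smul_apply, dft_shift, smul_eq_mul, neg_mul, neg_neg]
      congr 1
      linear_combination c * ZMod.stdAddChar (k₀ * k) * norm_mul_phase (dft θ k)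
    have h := tendsto_mulVec (tendsto_const_nhds (x := (dftMatrix L)ᴴ)) hlim
    rwa [conjTranspose_dftMatrix_mulVec_dft] at h

lemma continuous_l2norm_sub (θ : ZMod L → ℂ) (s : ZMod L) :
    Continuous fun p : ℂ × (ZMod L → ℂ) => l2norm (θ - p.1 • shift s p.2) := by
  refine continuous_l2norm.comp (continuous_const.sub (continuous_fst.smul ?_))
  unfold shift
  fun_prop

/-- The optimal alignment is chosen without reference to an ultrafilter, yet its error is at most
that of the alignment suited to any given one. -/
lemma exists_alignment_minimizer (θ x : ZMod L → ℂ) :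
    ∃ (s : ZMod L) (α : ℂ), ‖α‖ = 1 ∧ ∀ (s' : ZMod L) (α' : ℂ), ‖α'‖ = 1 →
      l2norm (θ - α • shift s x) ≤ l2norm (θ - α' • shift s' x) := by
  have h : ∀ z : ZMod L → ℂ, ∃ α : ℂ, ‖α‖ = 1 ∧ ∀ α' : ℂ, ‖α'‖ = 1 →
      l2norm (θ - α • z) ≤ l2norm (θ - α' • z) := by
    intro z
    have hcont : Continuous fun α : ℂ => l2norm (θ - α • z) := continuous_l2norm.comp (by fun_prop)
    obtain ⟨α, hα, hmin⟩ := (isCompact_sphere (0 : ℂ) 1).exists_isMinOn ⟨1, by simp⟩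
      hcont.continuousOn
    exact ⟨α, mem_sphere_zero_iff_norm.mp hα,
      fun α' hα' => isMinOn_iff.mp hmin α' (mem_sphere_zero_iff_norm.mpr hα')⟩
  choose α hα hmin using h
  obtain ⟨s, hs⟩ := Finite.exists_min fun s => l2norm (θ - α (shift s x) • shift s x)
  exact ⟨s, α (shift s x), hα _, fun s' α' h' => (hs s').trans (hmin _ α' h')⟩

lemma tendsto_l2norm_sub_of_tendsto {ι : Type*} {l : Filter ι} {θ : ZMod L → ℂ}
    {x : ι → ZMod L → ℂ} {c : ℂ} (hc : ‖c‖ = 1) {k₀ : ZMod L}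
    (hx : Tendsto x l (𝓝 (c • shift (-k₀) θ))) :
    Tendsto (fun i => l2norm (θ - star c • shift k₀ (x i))) l (𝓝 0) := by
  have h := ((continuous_l2norm_sub θ k₀).tendsto (star c, c • shift (-k₀) θ)).comp
    (tendsto_const_nhds.prodMk_nhds hx)
  have e : l2norm (θ - star c • shift k₀ (c • shift (-k₀) θ)) = 0 := by
    rw [shift_limit_eq hc]
    simp [l2norm]
  simp only [e] at h
  exact h

end Recovery

end MRFA

end

theorem mainTheorem5 {L : ℕ} [NeZero L] {Ω : Type*} [MeasurableSpace Ω]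
    (μ : Measure Ω) [IsProbabilityMeasure μ]
    (θ : ZMod L → ℂ) (hθ : MRFA.l2norm θ = 1) (hθhat : ∀ k, 0 < ‖MRFA.dft θ k‖)
    (lam σ : ℝ≥0) (hlam : 0 < lam)
    (X : ℕ → Ω → ℂ × ZMod L × (ZMod L → ℂ))
    (hX : ∀ i, HasLaw (X i) (MRFA.latentLaw L lam σ) μ) (hXindep : iIndepFun X μ)
    (φ : Ω → ZMod L → ℝ) (hφ : HasLaw φ (MRFA.initialPhaseLaw L) μ)
    (hφX : IndepFun φ (fun ω i => X i ω) μ) :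
    ∀ᵐ ω ∂μ,
      ∀ run : ∀ N : ℕ, MRFA.AMRun σ 1 N (fun i => MRFA.observation θ (X i ω)) (φ ω),
        (∃ (s : ℕ → ZMod L) (α : ℕ → ℂ), (∀ N, ‖α N‖ = 1) ∧
          Tendsto (fun N => MRFA.l2norm (θ - α N • MRFA.shift (s N) (run N).estimate))
            atTop (𝓝 0)) ∧
        ((∀ m : ZMod L, m ≠ 0 →
            ∃ c : ℂ, Tendsto (fun N => (run N).u m 0 / ((‖(run N).u m 0‖ : ℝ) : ℂ)) atTop (𝓝 c)) →
          (∃ c : ℂ, Tendsto (fun N => (run N).q 1 0 / ((‖(run N).q 1 0‖ : ℝ) : ℂ)) atTop (𝓝 c)) →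
          ∃ (s : ZMod L) (α : ℂ), ‖α‖ = 1 ∧
            Tendsto (fun N => MRFA.l2norm (θ - α • MRFA.shift s (run N).estimate))
              atTop (𝓝 0)) := by
  have hties : ∀ᵐ ω ∂μ, ∀ ζ : ZMod L → ℂ, (∀ m, ζ m ^ L = 1) →
      ∀ k k', k ≠ k' → ‖MRFA.phaseSum ζ (φ ω) k‖ ≠ ‖MRFA.phaseSum ζ (φ ω) k'‖ := by
    have h := MRFA.ae_forall_norm_phaseSum_ne (L := L)
    rw [← hφ.map_eq] at h
    exact ae_of_ae_map hφ.aemeasurable h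
  filter_upwards [MRFA.ae_tendsto_statistics θ lam σ hX hXindep, hties] with ω hstat hties run
  have hlimit := MRFA.exists_limit_of_runs hθ hθhat hlam hstat.1 hstat.2 hties run
  refine ⟨?_, fun hu hq => ?_⟩
  · choose s α hα hmin using fun N => MRFA.exists_alignment_minimizer θ (run N).estimate
    refine ⟨s, α, hα, (tendsto_iff_ultrafilter _ _ _).mpr fun U hU => ?_⟩
    obtain ⟨ζ, k₀, c, -, -, -, hc, -, hest⟩ := hlimit U hU
    exact squeeze_zero (fun N => MRFA.l2norm_nonneg _)
      (fun N => hmin N k₀ (star c) (by rwa [norm_star]))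
      (MRFA.tendsto_l2norm_sub_of_tendsto hc hest)
  -- A reference ultrafilter V supplies the fixed shift and phase; every other U is then shown to
  -- have the same ζ, k₀ and c.
  · obtain ⟨V, hV⟩ := Ultrafilter.exists_le (atTop : Filter ℕ)
    obtain ⟨ζ, k₀, c, hζ0, hζ, hk₀, hc, hcq, -⟩ := hlimit V hV
    refine ⟨k₀, star c, by rwa [norm_star], (tendsto_iff_ultrafilter _ _ _).mpr fun U hU => ?_⟩
    obtain ⟨ζ', k₀', c', hζ0', hζ', hk₀', hc', hcq', hest'⟩ := hlimit U hU
    have hP : ∀ k, MRFA.phase (MRFA.dft θ k) ≠ 0 := fun k =>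
      norm_pos_iff.mp (by rw [MRFA.norm_phase (norm_pos_iff.mp (hθhat k))]; exact one_pos)
    have hζeq : ζ' = ζ := by
      ext m
      rcases eq_or_ne m 0 with rfl | hm
      · rw [hζ0, hζ0']
      · obtain ⟨b, hb⟩ := hu m hm
        exact mul_right_cancel₀ (mul_ne_zero (hP 0) (star_ne_zero.mpr (hP m)))
          ((tendsto_nhds_unique (hζ' m hm) (hb.mono_left hU)).trans
            (tendsto_nhds_unique (hb.mono_left hV) (hζ m hm)))
    subst hζeq
    -- Both are the strict maximizer of the same moduli, since ζ and φ coincide.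
    have hkeq : k₀' = k₀ := by
      by_contra hne
      exact lt_asymm (hk₀ k₀' hne) (hk₀' k₀ (Ne.symm hne))
    obtain ⟨b, hb⟩ := hq
    have hceq : c' = c := mul_right_cancel₀ (hP 0)
      ((tendsto_nhds_unique hcq' (hb.mono_left hU)).trans
        (tendsto_nhds_unique (hb.mono_left hV) hcq))
    subst hkeq hceq
    exact MRFA.tendsto_l2norm_sub_of_tendsto hc hest'
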